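/- Let $d\ge 1$, let $\Omega\subset\mathbb R^d$ be a polygonal/polyhedral domain (open, connected, with a finite simplicial mesh), let $\hat K$ be a fixed reference simplex with $|\hat K|=1$, and let $\mathcal L u=-\operatorname{div}(a\nabla u)+b\cdot\nabla u+cu$ be an elliptic operator on $\Omega$: $a,b,c$ are bounded and measurable, $a$ is uniformly positive definite, and the bilinear form $B(w,v)=\int_\Omega (a\nabla w\cdot\nabla v+(b\cdot\nabla w)v+cwv)\,dx$ is coercive on $H^1_0(\Omega)$. Then there is a constant $C>0$, depending only on $d$, $\Omega$, $\mathcal L$ and $\hat K$, such that the following holds. Let $f\in L^2(\Omega)$ and let $u\in H^2(\Omega)\cap C(\overline\Omega)$, with Hessian $H$, be a weak solution of $\mathcal Lu=f$ in $\Omega$, $u=g$ on $\partial\Omega$. Let $\mathcal T_h$ be a conforming simplicial mesh of $\Omega$ with $N$ elements, with affine maps $F_K$ from $\hat K$ onto $K\in\mathcal T_h$, and let $u_h$ be the linear finite element solution: $u_h$ is continuous and piecewise affine, $u_h=g$ at the boundary vertices, and $B(u_h,v)=\int_\Omega fv\,dx$ for all continuous piecewise affine $v$ vanishing on $\partial\Omega$.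 Let $R$ be a symmetric matrix field (the recovered Hessian), let $R_K$ be an average of $R$ over $K$ (its mean with respect to some probability measure on $K$), and let $\alpha_h>0$. Write $|A|=\sqrt{A^2}$ for symmetric $A$ and $\|\cdot\|_2$ for the spectral norm. Assume that for all $K\in\mathcal T_h$ and almost all $x\in K$ $$C_{R-,K}\,I\le(\alpha_hI+|R_K|)^{-1}(\alpha_hI+|H(x)|),\qquad(\alpha_hI+|R_K|)^{-1}|H(x)|\le C_{R+,K}\,I,$$ where the inequalities mean that all eigenvalues of the matrix product are $\ge C_{R-,K}$, respectively $\le C_{R+,K}$, and that for constants $C_{R-},C_{R+}>0$ $$C_{R-}\le\min_{K\in\mathcal T_h}C_{R-,K},\qquad\sqrt{\frac1N\sum_{K\in\mathcal T_h}C_{R+,K}^2}\le C_{R+}.$$ Let $$M_K=\det(\alpha_hI+|R_K|)^{-\frac1{d+2}}\,\|\alpha_hI+|R_K|\|_2^{\frac2{d+2}}\,(\alpha_hI+|R_K|)$$ and assume that the mesh is quasi-$M$-uniform with constants $C_{eq},C_{ali}\ge1$: for all $K\in\mathcal T_h$ $$|K|\det(M_K)^{\frac12}\le C_{eq}\frac1N\sum_{\tilde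 K\in\mathcal T_h}|\tilde K|\det(M_{\tilde K})^{\frac12},\qquad\frac1d\operatorname{tr}\bigl((F_K')^TM_KF_K'\bigr)\le C_{ali}|K|^{\frac2d}\det(M_K)^{\frac1d}.$$ Then $$|u-u_h|_{H^1(\Omega)}\le C\cdot C_{ali}^{\frac{d+1}2}C_{eq}^{\frac{d+2}{2d}}\cdot\frac{C_{R+}}{C_{R-}}\cdot N^{-\frac1d}\,\Bigl\|\det(\alpha_hI+|H|)^{\frac1d}(\alpha_hI+|H|)\Bigr\|_{L^{\frac d{d+2}}(\Omega)}^{\frac12},$$ where the $L^{d/(d+2)}$ quasi-norm is that of the spectral norm of the matrix function. -/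

import Mathlib

open MeasureTheory
open scoped ContDiff

namespace AnisoFEM

noncomputable section

/-- `ℝ^d` with the Euclidean norm. -/
abbrev Space (d : ℕ) : Type := EuclideanSpace ℝ (Fin d)

/-- Real `d × d` matrices. -/
abbrev Mat (d : ℕ) : Type := Matrix (Fin d) (Fin d) ℝ

/-! ### Matrices -/

open scoped MatrixOrder in
/-- `|A| = √(A²)` for a symmetric matrix `A` (positive semidefinite square root). -/
def matAbs {d : ℕ} (A : Mat d) : Mat d := CFC.sqrt (A * A)

/-- The regularised matrix `α I + |A|`. -/
def regAbs {d : ℕ} (α : ℝ) (A : Mat d) : Mat d := α • (1 : Mat d) + matAbs A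

/-- The spectral norm `‖A‖₂`, the operator norm induced by the Euclidean norm. -/
def norm2 {d : ℕ} (A : Mat d) : ℝ := ‖Matrix.toEuclideanCLM (n := Fin d) (𝕜 := ℝ) A‖

/-- `c I ≤ S`: all eigenvalues of `S` are at least `c`. It is used for products `S = A⁻¹ B` with `A`
symmetric positive definite and `B` symmetric, which are similar to symmetric matrices. -/
def ScalarLE {d : ℕ} (c : ℝ) (S : Mat d) : Prop := ∀ μ ∈ spectrum ℝ S, c ≤ μ

/-- `S ≤ c I`: all eigenvalues of `S` are at most `c`. -/
def LEScalar {d : ℕ} (S : Mat d) (c : ℝ) : Prop := ∀ μ ∈ spectrum ℝ S, μ ≤ c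

/-- The metric tensor
`M = det(α I + |R|)^{-1/(d+2)} ‖α I + |R|‖₂^{2/(d+2)} (α I + |R|)`. -/
def metric {d : ℕ} (α : ℝ) (R : Mat d) : Mat d :=
  ((regAbs α R).det ^ (-(1 / ((d : ℝ) + 2))) * norm2 (regAbs α R) ^ (2 / ((d : ℝ) + 2))) •
    regAbs α R

/-! ### Weak derivatives and `H²` -/

/-- Test functions `φ ∈ C_c^∞(Ω)`. -/
def IsTestFunction {d : ℕ} (Ω : Set (Space d)) (φ : Space d → ℝ) : Prop :=
  ContDiff ℝ ∞ φ ∧ HasCompactSupport φ ∧ tsupport φ ⊆ Ω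

/-- `w'` is the weak partial derivative `∂w/∂xᵢ` in `Ω`. -/
def HasWeakPartial {d : ℕ} (Ω : Set (Space d)) (i : Fin d) (w w' : Space d → ℝ) : Prop :=
  ∀ φ, IsTestFunction Ω φ →
    ∫ x in Ω, w x * gradient φ x i = -∫ x in Ω, w' x * φ x

/-- `u ∈ H²(Ω)`, with weak gradient `Du` and weak Hessian `H`. -/
structure IsH2 {d : ℕ} (Ω : Set (Space d)) (u : Space d → ℝ) (Du : Space d → Space d)
    (H : Space d → Mat d) : Prop where
  memLp : MemLp u 2 (volume.restrict Ω)
  memLp_grad : ∀ i, MemLp (fun x => Du x i) 2 (volume.restrict Ω)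
  memLp_hess : ∀ i j, MemLp (fun x => H x i j) 2 (volume.restrict Ω)
  grad : ∀ i, HasWeakPartial Ω i u (fun x => Du x i)
  hess : ∀ i j, HasWeakPartial Ω j (fun x => Du x i) (fun x => H x i j)

/-! ### The boundary value problem -/

/-- Coefficients of `𝓛 u = -div (a ∇u) + b · ∇u + c u`. -/
structure Coeffs (d : ℕ) where
  a : Space d → Mat d
  b : Space d → Space d
  c : Space d → ℝ

/-- The bilinear form `∫_Ω (a ∇w · ∇v + (b · ∇w) v + c w v)` of `𝓛`; the gradients of `w` and `v`
are passed explicitly as `Dw` and `Dv`. -/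
def Coeffs.form {d : ℕ} (L : Coeffs d) (Ω : Set (Space d))
    (w : Space d → ℝ) (Dw : Space d → Space d) (v : Space d → ℝ) (Dv : Space d → Space d) : ℝ :=
  ∫ x in Ω, (inner ℝ (Matrix.toEuclideanLin (L.a x) (Dw x)) (Dv x)
    + inner ℝ (L.b x) (Dw x) * v x + L.c x * w x * v x)

/-- `𝓛` is an elliptic operator on `Ω`: bounded measurable coefficients, uniformly positive
definite principal part, and a bilinear form that is coercive on `H¹₀(Ω)`
(equivalently, by density, on `C_c^∞(Ω)`). -/
structure Coeffs.IsElliptic {d : ℕ} (L : Coeffs d) (Ω : Set (Space d)) : Prop where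
  bdd_a : ∀ i j, MemLp (fun x => L.a x i j) ⊤ (volume.restrict Ω)
  bdd_b : ∀ i, MemLp (fun x => L.b x i) ⊤ (volume.restrict Ω)
  bdd_c : MemLp L.c ⊤ (volume.restrict Ω)
  elliptic : ∃ lam > 0, ∀ᵐ x ∂(volume.restrict Ω), ∀ ξ : Space d,
    lam * ‖ξ‖ ^ 2 ≤ inner ℝ (Matrix.toEuclideanLin (L.a x) ξ) ξ
  coercive : ∃ β > 0, ∀ φ, IsTestFunction Ω φ →
    β * ∫ x in Ω, ‖gradient φ x‖ ^ 2 ≤ L.form Ω φ (gradient φ) φ (gradient φ)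

/-- `u`, with weak gradient `Du`, is a (weak) solution of `𝓛 u = f` in `Ω`, `u = g` on `∂Ω`.
Here `u` is continuous up to the boundary, so that its boundary and nodal values make sense. -/
structure IsSolution {d : ℕ} (L : Coeffs d) (Ω : Set (Space d)) (f g u : Space d → ℝ)
    (Du : Space d → Space d) : Prop where
  continuousOn : ContinuousOn u (closure Ω)
  eq : ∀ φ, IsTestFunction Ω φ → L.form Ω u Du φ (gradient φ) = ∫ x in Ω, f x * φ x
  boundary : ∀ x ∈ frontier Ω, u x = g x

/-! ### Simplicial meshes and linear finite elements -/

/-- A (conforming) simplicial mesh of `Ω`: a finite simplicial complex, all of whose maximal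
simplices are `d`-dimensional, that triangulates `closure Ω` and whose faces resolve `∂Ω`. -/
structure Mesh {d : ℕ} (Ω : Set (Space d)) extends
    Geometry.SimplicialComplex ℝ (Space d) where
  finite : faces.Finite
  pure : ∀ s ∈ faces, ∃ t ∈ faces, s ⊆ t ∧ t.card = d + 1
  space_eq : toSimplicialComplex.space = closure Ω
  boundary : ∀ x ∈ frontier Ω, ∃ s ∈ faces,
    x ∈ convexHull ℝ (s : Set (Space d)) ∧ convexHull ℝ (s : Set (Space d)) ⊆ frontier Ω

/-- A polygonal / polyhedral domain: open, connected, and admitting a simplicial mesh. -/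
structure IsPolyhedralDomain {d : ℕ} (Ω : Set (Space d)) : Prop where
  isOpen : IsOpen Ω
  isConnected : IsConnected Ω
  nonempty_mesh : Nonempty (Mesh Ω)

/-- The simplex spanned by a finite set of vertices. -/
def simplex {d : ℕ} (K : Finset (Space d)) : Set (Space d) := convexHull ℝ (K : Set (Space d))

/-- The volume `|K|`. -/
def vol {d : ℕ} (K : Finset (Space d)) : ℝ := volume.real (simplex K)

/-- The mesh elements, given by their vertex sets. -/
def Mesh.elements {d : ℕ} {Ω : Set (Space d)} (T : Mesh Ω) : Finset (Finset (Space d)) :=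
  {K ∈ T.finite.toFinset | K.card = d + 1}

/-- The number `N` of mesh elements. -/
def Mesh.N {d : ℕ} {Ω : Set (Space d)} (T : Mesh Ω) : ℕ := T.elements.card

/-- The linear finite element space: continuous, affine on every element. -/
def Mesh.IsFEFunction {d : ℕ} {Ω : Set (Space d)} (T : Mesh Ω) (v : Space d → ℝ) : Prop :=
  ContinuousOn v (closure Ω) ∧
    ∀ K ∈ T.elements, ∃ ℓ : Space d →ᵃ[ℝ] ℝ, Set.EqOn v ℓ (simplex K)

/-- `uh` is the linear finite element solution: it takes the boundary data at the boundary
vertices and satisfies the Galerkin equations for all finite element functions that vanish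
on `∂Ω`. Gradients of finite element functions are the elementwise ones. -/
structure IsFESolution {d : ℕ} {Ω : Set (Space d)} (L : Coeffs d) (T : Mesh Ω)
    (f g uh : Space d → ℝ) : Prop where
  mem : T.IsFEFunction uh
  boundary : ∀ p, p ∈ T.vertices → p ∈ frontier Ω → uh p = g p
  galerkin : ∀ v, T.IsFEFunction v → (∀ x ∈ frontier Ω, v x = 0) →
    L.form Ω uh (gradient uh) v (gradient v) = ∫ x in Ω, f x * v x

/-- The vertex set of a reference element: a nondegenerate simplex of unit volume. -/
def IsReferenceElement {d : ℕ} (V : Finset (Space d)) : Prop :=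
  V.card = d + 1 ∧ AffineIndependent ℝ ((↑) : V → Space d) ∧ vol V = 1

/-- The Jacobian matrix `F'` of an affine map `F`. -/
def jacobian {d : ℕ} (F : Space d →ᵃ[ℝ] Space d) : Mat d := Matrix.toEuclideanLin.symm F.linear

/-- The mesh is quasi-`M`-uniform for the metric tensor `M_K`: equidistribution with constant
`Ceq` and alignment with constant `Cali`, where `F_K` maps the reference element onto `K`. -/
structure IsQuasiMUniform {d : ℕ} {Ω : Set (Space d)} (T : Mesh Ω)
    (F : Finset (Space d) → Space d →ᵃ[ℝ] Space d) (M : Finset (Space d) → Mat d)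
    (Ceq Cali : ℝ) : Prop where
  equidistribution : ∀ K ∈ T.elements,
    vol K * (M K).det ^ (1 / 2 : ℝ) ≤
      Ceq * ((1 / (T.N : ℝ)) * ∑ K' ∈ T.elements, vol K' * (M K').det ^ (1 / 2 : ℝ))
  alignment : ∀ K ∈ T.elements,
    (1 / (d : ℝ)) * ((jacobian (F K)).transpose * M K * jacobian (F K)).trace ≤
      Cali * vol K ^ (2 / (d : ℝ)) * (M K).det ^ (1 / (d : ℝ))

/-- `A` is an average of the matrix field `R` over `S`, i.e. its mean with respect to some
probability measure on `S` (normalised Lebesgue measure, nodal averages, quadrature rules, ...). -/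
def IsAverageOver {d : ℕ} (S : Set (Space d)) (R : Space d → Mat d) (A : Mat d) : Prop :=
  ∃ μ : Measure (Space d), IsProbabilityMeasure μ ∧ μ Sᶜ = 0 ∧
    ∀ i j, Integrable (fun x => R x i j) μ ∧ A i j = ∫ x, R x i j ∂μ

/-! ### The quantities in the error bound -/

/-- The `H¹(Ω)` semi-norm of a function whose gradient is `G`. -/
def gradSeminorm {d : ℕ} (Ω : Set (Space d)) (G : Space d → Space d) : ℝ :=
  Real.sqrt (∫ x in Ω, ‖G x‖ ^ 2)

/-- `‖det(α I + |H|)^{1/d} (α I + |H|)‖_{L^{d/(d+2)}(Ω)}`, with the spectral norm of matrices. -/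
def hessianFactor {d : ℕ} (Ω : Set (Space d)) (α : ℝ) (H : Space d → Mat d) : ℝ :=
  (eLpNorm (fun x => norm2 ((regAbs α (H x)).det ^ (1 / (d : ℝ)) • regAbs α (H x)))
    (ENNReal.ofReal ((d : ℝ) / ((d : ℝ) + 2))) (volume.restrict Ω)).toReal

end

end AnisoFEM

open AnisoFEM

/-!
By Céa's lemma the finite element error is bounded, up to a constant, by the `H¹` error of the
nodal interpolant `v` of `u`. The boundary values enter here: `uh - v` is a finite element function
vanishing on `∂Ω`, and soft thresholding followed by mollification turns it into a limit of test
functions, the only functions for which coercivity is assumed.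

On an element `K` we have `|H| ≤ C_{R+,K} A` with `A = α I + |R_K|`, so the Taylor remainder of `u`
at a point of `K` is at most `C_{R+,K} / 2` times the quadratic form of `A`, as one sees by
mollifying `u`. An affine function whose differences between the vertices of `K` are small has a
small gradient, and pulling `A` back to the reference element by `F_K` turns this, up to alignment,
into the bound `‖A‖₂ det(F_K'ᵀ A F_K')^{1/d}` for the squared interpolation error. The product of
this expression with `|K|` is exactly `(|K| det(M_K)^{1/2})^{(d+2)/d}`, which is how the metric
tensor `M_K` arises. Equidistribution sums these contributions, and `C_{R-} A ≤ α I + |H|` compares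
the sum of the metric volumes with the `L^{d/(d+2)}` quasi-norm.
-/

namespace AnisoFEM

noncomputable section

open Filter Topology
open scoped NNReal

section Matrices

open Matrix
open scoped MatrixOrder

section Loewner

variable {n : Type*} [Fintype n] [DecidableEq n]

theorem exists_isHermitian_unit_mul_self {A : Matrix n n ℝ} (hA : A.PosDef) :
    ∃ P : (Matrix n n ℝ)ˣ, (P : Matrix n n ℝ).IsHermitian ∧ (P * P : Matrix n n ℝ) = A := by
  have hsq : CFC.sqrt A * CFC.sqrt A = A := CFC.sqrt_mul_sqrt_self A hA.posSemidef.nonneg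
  obtain ⟨P, hP⟩ : IsUnit (CFC.sqrt A) :=
    (CFC.isUnit_sqrt_iff A hA.posSemidef.nonneg).2 hA.isUnit
  exact ⟨P, hP ▸ (nonneg_iff_posSemidef.1 (CFC.sqrt_nonneg A)).isHermitian, hP ▸ hsq⟩

theorem smul_le_of_forall_le_spectrum {A B : Matrix n n ℝ} {c : ℝ} (hA : A.PosDef)
    (hB : B.IsHermitian) (h : ∀ μ ∈ spectrum ℝ (A⁻¹ * B), c ≤ μ) : c • A ≤ B := by
  obtain ⟨P, hP, rfl⟩ := exists_isHermitian_unit_mul_self hA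
  set P' : Matrix n n ℝ := ↑P⁻¹ with hP'
  have hP'h : P'.IsHermitian := by
    rw [hP', coe_units_inv]
    exact hP.inv
  have hY : IsSelfAdjoint (P' * B * P') := by
    rw [isSelfAdjoint_iff, star_eq_conjTranspose, conjTranspose_mul, conjTranspose_mul, hP'h.eq,
      hB.eq, mul_assoc]
  have hsimilar : spectrum ℝ (P' * B * P') = spectrum ℝ ((P * P : Matrix n n ℝ)⁻¹ * B) := by
    rw [← spectrum.units_conjugate (a := (P * P : Matrix n n ℝ)⁻¹ * B) (u := P), Matrix.mul_inv_rev,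
      ← coe_units_inv]
    simp [hP', mul_assoc]
  have hle : algebraMap ℝ _ c ≤ P' * B * P' :=
    algebraMap_le_of_le_spectrum (fun μ hμ => h μ (hsimilar ▸ hμ)) hY
  calc c • (P * P : Matrix n n ℝ) = P * algebraMap ℝ _ c * P := by
        simp [Algebra.algebraMap_eq_smul_one]
    _ ≤ P * (P' * B * P') * P := IsSelfAdjoint.conjugate_le_conjugate hle hP
    _ = B := by simp [hP', mul_assoc]

theorem det_le_det_of_le {A B : Matrix n n ℝ} (hA : A.PosDef) (h : A ≤ B) : A.det ≤ B.det := by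
  obtain ⟨P, hP, rfl⟩ := exists_isHermitian_unit_mul_self hA
  set P' : Matrix n n ℝ := ↑P⁻¹ with hP'
  have hP'h : P'.IsHermitian := by
    rw [hP', coe_units_inv]
    exact hP.inv
  set Y := P' * B * P' with hYdef
  have hY : algebraMap ℝ _ 1 ≤ Y := by
    simpa [hYdef, hP', mul_assoc] using IsSelfAdjoint.conjugate_le_conjugate h hP'h
  have hYh : Y.IsHermitian := by
    simpa using (le_iff.1 hY).isHermitian.add (isHermitian_one (n := n) (α := ℝ))
  have hdet : 1 ≤ Y.det := by
    have heig (i : n) : 1 ≤ hYh.eigenvalues i :=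
      (algebraMap_le_iff_le_spectrum hYh).1 hY _ (hYh.eigenvalues_mem_spectrum_real i)
    rw [hYh.det_eq_prod_eigenvalues]
    exact Finset.one_le_prod fun i _ => heig i
  have hB : B = P * Y * P := by simp [hYdef, hP', mul_assoc]
  rw [hB, det_mul, det_mul, det_mul]
  nlinarith [mul_self_nonneg (P : Matrix n n ℝ).det]

theorem le_trace_smul_one {S : Matrix n n ℝ} (hS : S.PosSemidef) : S ≤ S.trace • 1 := by
  have hH := hS.isHermitian
  rw [← Algebra.algebraMap_eq_smul_one]
  refine le_algebraMap_of_spectrum_le (fun μ hμ => ?_) hH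
  rw [hH.spectrum_real_eq_range_eigenvalues] at hμ
  obtain ⟨i, rfl⟩ := hμ
  rw [hH.trace_eq_sum_eigenvalues]
  exact Finset.single_le_sum (f := hH.eigenvalues) (fun j _ => hS.eigenvalues_nonneg j)
    (Finset.mem_univ i)

theorem det_smul_one_le {S : Matrix n n ℝ} (hS : S.PosDef) :
    S.det • 1 ≤ S.trace ^ (Fintype.card n - 1) • S := by
  cases isEmpty_or_nonempty n
  · exact (Subsingleton.elim _ _).le
  have hH := hS.isHermitian
  have hp : 0 < S.trace ^ (Fintype.card n - 1) := pow_pos hS.trace_pos _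
  have hle : algebraMap ℝ _ (S.det / S.trace ^ (Fintype.card n - 1)) ≤ S := by
    refine algebraMap_le_of_le_spectrum (fun μ hμ => ?_) hH
    rw [hH.spectrum_real_eq_range_eigenvalues] at hμ
    obtain ⟨i, rfl⟩ := hμ
    have hcard : (Finset.univ.erase i).card = Fintype.card n - 1 := by
      rw [Finset.card_erase_of_mem (Finset.mem_univ i), Finset.card_univ]
    rw [div_le_iff₀ hp, hH.det_eq_prod_eigenvalues,
      ← Finset.mul_prod_erase _ _ (Finset.mem_univ i), ← hcard, ← Finset.prod_const]
    refine mul_le_mul_of_nonneg_left ?_ (hS.posSemidef.eigenvalues_nonneg i)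
    refine Finset.prod_le_prod (fun j _ => hS.posSemidef.eigenvalues_nonneg j) fun j _ => ?_
    rw [hH.trace_eq_sum_eigenvalues]
    exact Finset.single_le_sum (f := hH.eigenvalues)
      (fun j _ => hS.posSemidef.eigenvalues_nonneg j) (Finset.mem_univ j)
  rw [Algebra.algebraMap_eq_smul_one] at hle
  have := smul_le_smul_of_nonneg_left hle hp.le
  rwa [smul_smul, mul_div_cancel₀ _ hp.ne'] at this

end Loewner

variable {d : ℕ}

theorem smul_le_of_scalarLE {A B : Mat d} {c : ℝ} (hA : A.PosDef) (hB : B.IsHermitian)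
    (h : ScalarLE c (A⁻¹ * B)) : c • A ≤ B :=
  smul_le_of_forall_le_spectrum hA hB h

theorem le_smul_of_leScalar {A B : Mat d} {c : ℝ} (hA : A.PosDef) (hB : B.IsHermitian)
    (h : LEScalar (A⁻¹ * B) c) : B ≤ c • A := by
  rw [← neg_le_neg_iff, ← neg_smul]
  refine smul_le_of_forall_le_spectrum hA hB.neg fun μ hμ => ?_
  rw [mul_neg, ← spectrum.neg_eq, Set.mem_neg] at hμ
  linarith [h _ hμ]

theorem matAbs_posSemidef (A : Mat d) : (matAbs A).PosSemidef :=
  nonneg_iff_posSemidef.1 (CFC.sqrt_nonneg _)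

theorem regAbs_isHermitian (α : ℝ) (A : Mat d) : (regAbs α A).IsHermitian :=
  (isHermitian_one.smul (star_trivial α)).add (matAbs_posSemidef A).isHermitian

theorem regAbs_posDef {α : ℝ} (hα : 0 < α) (A : Mat d) : (regAbs α A).PosDef :=
  PosDef.add_posSemidef (PosDef.one.smul hα) (matAbs_posSemidef A)

theorem matAbs_eq_cfcAbs {H : Mat d} (hH : H.IsHermitian) : matAbs H = CFC.abs H := by
  rw [matAbs, CFC.abs, star_eq_conjTranspose, hH.eq]

theorem le_matAbs {H : Mat d} (hH : H.IsHermitian) : H ≤ matAbs H := by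
  rw [← sub_nonneg, matAbs_eq_cfcAbs hH, CFC.abs_sub_self H hH]
  exact smul_nonneg zero_le_two (CFC.negPart_nonneg H)

theorem neg_matAbs_le {H : Mat d} (hH : H.IsHermitian) : -matAbs H ≤ H := by
  rw [← sub_nonneg, sub_neg_eq_add, add_comm, matAbs_eq_cfcAbs hH, CFC.abs_add_self H hH]
  exact smul_nonneg zero_le_two (CFC.posPart_nonneg H)

/-- The quadratic form `ξ ↦ ξᵀ A ξ`, through which all matrix inequalities are applied to
vectors. -/
def quad (A : Mat d) (ξ : Space d) : ℝ := inner ℝ ξ (toEuclideanCLM (𝕜 := ℝ) A ξ)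

theorem continuous_quad (A : Mat d) : Continuous (quad A) :=
  continuous_id.inner (toEuclideanCLM (𝕜 := ℝ) A).continuous

theorem quad_eq_dotProduct (A : Mat d) (ξ : Space d) : quad A ξ = ξ.ofLp ⬝ᵥ A *ᵥ ξ.ofLp :=
  inner_toEuclideanCLM A ξ ξ

theorem quad_eq_sum (A : Mat d) (ξ : Space d) : quad A ξ = ∑ i, ∑ j, ξ i * ξ j * A i j := by
  rw [quad_eq_dotProduct]
  simp only [dotProduct, mulVec, Finset.mul_sum]
  exact Finset.sum_congr rfl fun i _ => Finset.sum_congr rfl fun j _ => by ring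

theorem quad_neg (A : Mat d) (ξ : Space d) : quad (-A) ξ = -quad A ξ := by
  simp [quad]

theorem quad_smul (c : ℝ) (A : Mat d) (ξ : Space d) : quad (c • A) ξ = c * quad A ξ := by
  simp [quad, inner_smul_right]

theorem quad_one (ξ : Space d) : quad (1 : Mat d) ξ = ‖ξ‖ ^ 2 := by
  simp [quad]

theorem quad_nonneg {A : Mat d} (hA : A.PosSemidef) (ξ : Space d) : 0 ≤ quad A ξ := by
  rw [quad_eq_dotProduct]
  simpa using hA.dotProduct_mulVec_nonneg ξ.ofLp

theorem quad_mono {A B : Mat d} (h : A ≤ B) (ξ : Space d) : quad A ξ ≤ quad B ξ := by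
  have hsub := quad_nonneg (le_iff.1 h) ξ
  rw [quad, map_sub, _root_.sub_apply, inner_sub_right, sub_nonneg] at hsub
  exact hsub

theorem abs_quad_le_quad_matAbs {H : Mat d} (hH : H.IsHermitian) (ξ : Space d) :
    |quad H ξ| ≤ quad (matAbs H) ξ :=
  abs_le.2 ⟨quad_neg (matAbs H) ξ ▸ quad_mono (neg_matAbs_le hH) ξ, quad_mono (le_matAbs hH) ξ⟩

theorem quad_le_trace {S : Mat d} (hS : S.PosSemidef) (ξ : Space d) :
    quad S ξ ≤ S.trace * ‖ξ‖ ^ 2 := by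
  simpa only [quad_smul, quad_one] using quad_mono (le_trace_smul_one hS) ξ

theorem det_mul_sq_le_trace_pow_mul_quad {S : Mat d} (hS : S.PosDef) (ξ : Space d) :
    S.det * ‖ξ‖ ^ 2 ≤ S.trace ^ (d - 1) * quad S ξ := by
  simpa only [quad_smul, quad_one, Fintype.card_fin] using quad_mono (det_smul_one_le hS) ξ

theorem norm2_nonneg (A : Mat d) : 0 ≤ norm2 A := norm_nonneg _

theorem norm2_smul (c : ℝ) (A : Mat d) : norm2 (c • A) = |c| * norm2 A := by
  simp [norm2, norm_smul]

theorem quad_le_norm2 (A : Mat d) (ξ : Space d) : quad A ξ ≤ norm2 A * ‖ξ‖ ^ 2 :=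
  calc quad A ξ ≤ ‖ξ‖ * ‖toEuclideanCLM (𝕜 := ℝ) A ξ‖ := real_inner_le_norm _ _
    _ ≤ ‖ξ‖ * (norm2 A * ‖ξ‖) := by gcongr; exact ContinuousLinearMap.le_opNorm _ ξ
    _ = norm2 A * ‖ξ‖ ^ 2 := by ring

theorem norm2_le_of_quad_le {A : Mat d} (hA : A.PosSemidef) {m : ℝ} (hm : 0 ≤ m)
    (h : ∀ ξ, quad A ξ ≤ m * ‖ξ‖ ^ 2) : norm2 A ≤ m := by
  have hsym : (toEuclideanCLM (n := Fin d) (𝕜 := ℝ) A : Space d →ₗ[ℝ] Space d).IsSymmetric := by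
    rw [coe_toEuclideanCLM_eq_toEuclideanLin]
    exact isSymmetric_toEuclideanLin_iff.2 hA.isHermitian
  rw [norm2, ContinuousLinearMap.norm_eq_iSup_rayleighQuotient _ hsym]
  refine ciSup_le fun ξ => ?_
  have hquad : (toEuclideanCLM (n := Fin d) (𝕜 := ℝ) A).reApplyInnerSelf ξ = quad A ξ := by
    rw [ContinuousLinearMap.reApplyInnerSelf_apply, quad, real_inner_comm]
    rfl
  rw [ContinuousLinearMap.rayleighQuotient, hquad,
    abs_of_nonneg (div_nonneg (quad_nonneg hA ξ) (by positivity))]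
  exact div_le_of_le_mul₀ (by positivity) hm (h ξ)

theorem norm2_mono {A B : Mat d} (hA : A.PosSemidef) (h : A ≤ B) : norm2 A ≤ norm2 B :=
  norm2_le_of_quad_le hA (norm2_nonneg B) fun ξ => (quad_mono h ξ).trans (quad_le_norm2 B ξ)

theorem norm2_pos (hd : 1 ≤ d) {A : Mat d} (hA : A.PosDef) : 0 < norm2 A := by
  have : Nonempty (Fin d) := ⟨⟨0, hd⟩⟩
  refine norm_pos_iff.2 ((map_ne_zero_iff _ (toEuclideanCLM (𝕜 := ℝ)).injective).2 ?_)
  rintro rfl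
  exact hA.det_pos.ne' (det_zero)

end Matrices

section AffineFunctions

variable {E : Type*}

theorem abs_affineMap_le_of_mem_convexHull [AddCommGroup E] [Module ℝ E] (ℓ : E →ᵃ[ℝ] ℝ)
    {s : Set E} {m : ℝ} (h : ∀ p ∈ s, |ℓ p| ≤ m) {x : E} (hx : x ∈ convexHull ℝ s) :
    |ℓ x| ≤ m := by
  have hsub : convexHull ℝ s ⊆ ℓ ⁻¹' Set.Icc (-m) m :=
    convexHull_min (fun p hp => abs_le.1 (h p hp)) ((convex_Icc (-m) m).affine_preimage ℓ)
  exact abs_le.2 (hsub hx)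

theorem affineMap_eqOn_convexHull [AddCommGroup E] [Module ℝ E] {ℓ ℓ' : E →ᵃ[ℝ] ℝ} {s : Set E}
    (h : s.EqOn ℓ ℓ') : (convexHull ℝ s).EqOn ℓ ℓ' :=
  (AffineMap.eqOn_affineSpan h).mono (convexHull_subset_affineSpan s)

variable [NormedAddCommGroup E] [InnerProductSpace ℝ E] [FiniteDimensional ℝ E]

/-- The constant gradient of an affine function. -/
def affineGradient (ℓ : E →ᵃ[ℝ] ℝ) : E :=
  (InnerProductSpace.toDual ℝ E).symm (LinearMap.toContinuousLinearMap ℓ.linear)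

theorem inner_affineGradient (ℓ : E →ᵃ[ℝ] ℝ) (ξ : E) :
    inner ℝ (affineGradient ℓ) ξ = ℓ.linear ξ := by
  simp [affineGradient]

theorem affineMap_sub_apply_eq_inner (ℓ : E →ᵃ[ℝ] ℝ) (x y : E) :
    ℓ x - ℓ y = inner ℝ (affineGradient ℓ) (x - y) := by
  rw [inner_affineGradient]
  exact (ℓ.linearMap_vsub x y).symm

theorem hasGradientAt_affineMap (ℓ : E →ᵃ[ℝ] ℝ) (x : E) :
    HasGradientAt ℓ (affineGradient ℓ) x := by
  rw [hasGradientAt_iff_hasFDerivAt, affineGradient, LinearIsometryEquiv.apply_symm_apply]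
  rw [ℓ.decomp]
  exact (LinearMap.toContinuousLinearMap ℓ.linear).hasFDerivAt.add_const (ℓ 0)

theorem hasGradientAt_of_eqOn_affineMap {s : Set E} {v : E → ℝ} {ℓ : E →ᵃ[ℝ] ℝ} (h : s.EqOn v ℓ)
    {x : E} (hx : x ∈ interior s) : HasGradientAt v (affineGradient ℓ) x :=
  (hasGradientAt_affineMap ℓ x).congr_of_eventuallyEq (h.eventuallyEq_of_mem
    (mem_interior_iff_mem_nhds.1 hx))

end AffineFunctions

section Simplices

variable {d : ℕ} {s t : Finset (Space d)}

theorem isCompact_simplex (s : Finset (Space d)) : IsCompact (simplex s) :=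
  s.finite_toSet.isCompact_convexHull ℝ

theorem convex_simplex (s : Finset (Space d)) : Convex ℝ (simplex s) := convex_convexHull ℝ _

theorem simplex_mono (h : s ⊆ t) : simplex s ⊆ simplex t :=
  convexHull_mono (Finset.coe_subset.2 h)

theorem mem_simplex {p : Space d} (hp : p ∈ s) : p ∈ simplex s :=
  subset_convexHull ℝ _ hp

theorem volume_frontier_simplex (s : Finset (Space d)) : volume (frontier (simplex s)) = 0 :=
  (convex_simplex s).addHaar_frontier volume

/-- Barycentric coordinates on a nondegenerate `d`-simplex. -/
def barycentricBasis (hs : AffineIndependent ℝ ((↑) : s → Space d)) (hcard : s.card = d + 1) :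
    AffineBasis s ℝ (Space d) :=
  ⟨(↑), hs, hs.affineSpan_eq_top_iff_card_eq_finrank_add_one.2 (by simpa using hcard)⟩

theorem interior_simplex (hs : AffineIndependent ℝ ((↑) : s → Space d)) (hcard : s.card = d + 1) :
    interior (simplex s) = {x | ∀ p, 0 < (barycentricBasis hs hcard).coord p x} := by
  rw [← (barycentricBasis hs hcard).interior_convexHull]
  exact congrArg (fun t => interior (convexHull ℝ t)) Subtype.range_coe.symm

theorem interior_simplex_nonempty (hs : AffineIndependent ℝ ((↑) : s → Space d))
    (hcard : s.card = d + 1) : (interior (simplex s)).Nonempty := by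
  rw [simplex, interior_convexHull_nonempty_iff_affineSpan_eq_top]
  exact (congrArg (affineSpan ℝ) Subtype.range_coe.symm).trans (barycentricBasis hs hcard).tot

theorem closure_interior_simplex (hs : AffineIndependent ℝ ((↑) : s → Space d))
    (hcard : s.card = d + 1) : closure (interior (simplex s)) = simplex s := by
  rw [(convex_simplex s).closure_interior_eq_closure_of_nonempty_interior
    (interior_simplex_nonempty hs hcard), (isCompact_simplex s).isClosed.closure_eq]

theorem vol_nonneg (s : Finset (Space d)) : 0 ≤ vol s := measureReal_nonneg

theorem vol_pos (hs : AffineIndependent ℝ ((↑) : s → Space d)) (hcard : s.card = d + 1) :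
    0 < vol s :=
  ENNReal.toReal_pos
    (Measure.measure_pos_of_nonempty_interior _ (interior_simplex_nonempty hs hcard)).ne'
    (isCompact_simplex s).measure_lt_top.ne

theorem exists_affine_interpolant (hs : AffineIndependent ℝ ((↑) : s → Space d))
    (hcard : s.card = d + 1) (u : Space d → ℝ) :
    ∃ ℓ : Space d →ᵃ[ℝ] ℝ, (s : Set (Space d)).EqOn ℓ u := by
  let b := barycentricBasis hs hcard
  let φ : (s → ℝ) →ₗ[ℝ] ℝ := Fintype.linearCombination ℝ fun p => u p
  refine ⟨φ.toAffineMap.comp (AffineMap.pi fun p => b.coord p), fun p hp => ?_⟩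
  have hcoord (q : s) : b.coord q p = if q = ⟨p, hp⟩ then 1 else 0 := b.coord_apply q ⟨p, hp⟩
  simp [φ, Fintype.linearCombination_apply, hcoord]

end Simplices

section Meshes

variable {d : ℕ} {Ω : Set (Space d)} {T : Mesh Ω} {K K' s t : Finset (Space d)}

theorem Mesh.mem_elements : K ∈ T.elements ↔ K ∈ T.faces ∧ K.card = d + 1 := by
  simp [Mesh.elements]

theorem Mesh.mem_faces (hK : K ∈ T.elements) : K ∈ T.faces := (mem_elements.1 hK).1

theorem Mesh.card_eq (hK : K ∈ T.elements) : K.card = d + 1 := (mem_elements.1 hK).2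

theorem Mesh.affineIndependent (hK : K ∈ T.elements) :
    AffineIndependent ℝ ((↑) : K → Space d) :=
  T.indep (mem_faces hK)

theorem Mesh.exists_element_superset (hs : s ∈ T.faces) : ∃ K ∈ T.elements, s ⊆ K := by
  obtain ⟨K, hK, hsK, hcard⟩ := T.pure s hs
  exact ⟨K, mem_elements.2 ⟨hK, hcard⟩, hsK⟩

theorem Mesh.mem_vertices_of_mem_face (hs : s ∈ T.faces) {p : Space d} (hp : p ∈ s) :
    p ∈ T.vertices :=
  T.down_closed hs (Finset.singleton_subset_iff.2 hp) (Finset.singleton_nonempty p)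

theorem Mesh.mem_simplex_inter [DecidableEq (Space d)] (hs : s ∈ T.faces) (ht : t ∈ T.faces)
    {x : Space d} (hxs : x ∈ simplex s) (hxt : x ∈ simplex t) : x ∈ simplex (s ∩ t) := by
  rw [simplex, Finset.coe_inter]
  exact T.inter_subset_convexHull hs ht ⟨hxs, hxt⟩

theorem Mesh.vol_pos (hK : K ∈ T.elements) : 0 < vol K :=
  AnisoFEM.vol_pos (affineIndependent hK) (card_eq hK)

theorem Mesh.closure_eq (T : Mesh Ω) : closure Ω = ⋃ K ∈ T.elements, simplex K := by
  rw [← T.space_eq]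
  refine Set.Subset.antisymm (fun x hx => ?_) (Set.iUnion₂_subset fun K hK =>
    Geometry.SimplicialComplex.convexHull_subset_space (mem_faces hK))
  obtain ⟨s, hs, hxs⟩ := Geometry.SimplicialComplex.mem_space_iff.1 hx
  obtain ⟨K, hK, hsK⟩ := exists_element_superset hs
  exact Set.mem_biUnion hK (simplex_mono hsK hxs)

theorem Mesh.exists_mem_simplex (T : Mesh Ω) {x : Space d} (hx : x ∈ closure Ω) :
    ∃ K ∈ T.elements, x ∈ simplex K := by
  rw [T.closure_eq] at hx
  simpa using hx

theorem Mesh.simplex_subset_closure (hK : K ∈ T.elements) : simplex K ⊆ closure Ω := by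
  rw [T.closure_eq]
  exact Set.subset_biUnion_of_mem (u := simplex) hK

theorem Mesh.isBounded (T : Mesh Ω) : Bornology.IsBounded Ω := by
  refine Bornology.IsBounded.subset ?_ subset_closure
  rw [T.closure_eq]
  exact (T.elements.isCompact_biUnion fun K _ => isCompact_simplex K).isBounded

theorem Mesh.subset_of_mem_interior (hK : K ∈ T.elements) (hs : s ∈ T.faces) {x : Space d}
    (hx : x ∈ interior (simplex K)) (hxs : x ∈ simplex s) : K ⊆ s := by
  classical
  by_contra hne
  obtain ⟨p, hpK, hps⟩ := Finset.not_subset.1 hne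
  let b := barycentricBasis (affineIndependent hK) (card_eq hK)
  have hpos : 0 < b.coord ⟨p, hpK⟩ x := by
    rw [interior_simplex (affineIndependent hK) (card_eq hK)] at hx
    exact hx ⟨p, hpK⟩
  have hvanish : (↑(K ∩ s) : Set (Space d)).EqOn (b.coord ⟨p, hpK⟩)
      (AffineMap.const ℝ (Space d) (0 : ℝ)) := fun q hq => by
    obtain ⟨hqK, hqs⟩ := Finset.mem_inter.1 hq
    exact b.coord_apply_ne (i := ⟨p, hpK⟩) (j := ⟨q, hqK⟩) fun h => by
      obtain rfl : p = q := congrArg Subtype.val h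
      exact hps hqs
  exact hpos.ne' (affineMap_eqOn_convexHull hvanish
    (mem_simplex_inter (mem_faces hK) hs (interior_subset hx) hxs))

theorem Mesh.disjoint_interior (hK : K ∈ T.elements) (hK' : K' ∈ T.elements) (hne : K ≠ K') :
    Disjoint (interior (simplex K)) (interior (simplex K')) := by
  refine Set.disjoint_left.2 fun x hx hx' => hne ?_
  exact Finset.eq_of_subset_of_card_le
    (subset_of_mem_interior hK (mem_faces hK') hx (interior_subset hx'))
    (by rw [card_eq hK, card_eq hK'])

theorem Mesh.interior_simplex_subset (hΩ : IsOpen Ω) (hK : K ∈ T.elements) :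
    interior (simplex K) ⊆ Ω := by
  intro x hx
  by_contra hxΩ
  have hxf : x ∈ frontier Ω :=
    hΩ.frontier_eq ▸ ⟨simplex_subset_closure hK (interior_subset hx), hxΩ⟩
  obtain ⟨s, hs, hxs, hsub⟩ := T.boundary x hxf
  have hKs : simplex K ⊆ frontier Ω :=
    (simplex_mono (subset_of_mem_interior hK hs hx hxs)).trans hsub
  have hempty : interior (frontier Ω) = ∅ := by
    rw [← frontier_compl, interior_frontier hΩ.isClosed_compl]
  exact Set.notMem_empty x (hempty ▸ interior_mono hKs hx)

theorem Mesh.ae_exists_mem_interior (hΩ : IsOpen Ω) (T : Mesh Ω) :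
    ∀ᵐ x ∂(volume.restrict Ω), ∃ K ∈ T.elements, x ∈ interior (simplex K) := by
  have hfrontier : ∀ᵐ x ∂(volume : Measure (Space d)), ∀ K ∈ T.elements,
      x ∉ frontier (simplex K) :=
    (Finset.eventually_all T.elements).2 fun K _ =>
      measure_eq_zero_iff_ae_notMem.1 (volume_frontier_simplex K)
  rw [ae_restrict_iff' hΩ.measurableSet]
  filter_upwards [hfrontier] with x hx hxΩ
  obtain ⟨K, hK, hxK⟩ := T.exists_mem_simplex (subset_closure hxΩ)
  exact ⟨K, hK, by_contra fun hxi => hx K hK ⟨subset_closure hxK, hxi⟩⟩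

theorem Mesh.exists_eqOn_of_compatible (T : Mesh Ω) {Y : Type*} [Nonempty Y]
    (g : Finset (Space d) → Space d → Y)
    (hg : ∀ K ∈ T.elements, ∀ K' ∈ T.elements, (simplex K ∩ simplex K').EqOn (g K) (g K')) :
    ∃ v : Space d → Y, ∀ K ∈ T.elements, (simplex K).EqOn v (g K) := by
  have hvalue : ∀ x, ∃ y, ∀ K ∈ T.elements, x ∈ simplex K → y = g K x := fun x => by
    by_cases hx : ∃ K ∈ T.elements, x ∈ simplex K
    · obtain ⟨K, hK, hxK⟩ := hx
      exact ⟨g K x, fun K' hK' hxK' => hg K hK K' hK' ⟨hxK, hxK'⟩⟩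
    · exact ⟨Classical.arbitrary Y, fun K hK hxK => absurd ⟨K, hK, hxK⟩ hx⟩
  choose v hv using hvalue
  exact ⟨v, fun K hK x hx => hv x K hK hx⟩

theorem Mesh.continuousOn_closure (T : Mesh Ω) {Y : Type*} [TopologicalSpace Y] {v : Space d → Y}
    (hv : ∀ K ∈ T.elements, ContinuousOn v (simplex K)) : ContinuousOn v (closure Ω) := by
  have hunion : ⋃ K ∈ T.elements, simplex K = ⋃ K : T.elements, simplex K :=
    Set.biUnion_eq_iUnion (T.elements : Set (Finset (Space d))) fun K _ => simplex K
  rw [T.closure_eq, hunion]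
  exact (locallyFinite_of_finite _).continuousOn_iUnion
    (fun K => (isCompact_simplex _).isClosed) fun K => hv K K.2

theorem Mesh.exists_interpolant (T : Mesh Ω) (u : Space d → ℝ) :
    ∃ v, T.IsFEFunction v ∧ ∀ p ∈ T.vertices, v p = u p := by
  classical
  have hlocal : ∀ K, ∃ ℓ : Space d →ᵃ[ℝ] ℝ, K ∈ T.elements → (K : Set (Space d)).EqOn ℓ u :=
    fun K => by
      by_cases hK : K ∈ T.elements
      · obtain ⟨ℓ, hℓ⟩ := exists_affine_interpolant (affineIndependent hK) (card_eq hK) u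
        exact ⟨ℓ, fun _ => hℓ⟩
      · exact ⟨0, fun h => absurd h hK⟩
  choose ℓ hℓ using hlocal
  obtain ⟨v, hv⟩ := T.exists_eqOn_of_compatible (fun K => ⇑(ℓ K)) fun K hK K' hK' x hx => by
    refine affineMap_eqOn_convexHull (fun q hq => ?_)
      (mem_simplex_inter (mem_faces hK) (mem_faces hK') hx.1 hx.2)
    obtain ⟨hqK, hqK'⟩ := Finset.mem_inter.1 hq
    exact (hℓ K hK hqK).trans (hℓ K' hK' hqK').symm
  refine ⟨v, ⟨T.continuousOn_closure fun K hK => ?_, fun K hK => ⟨ℓ K, hv K hK⟩⟩, fun p hp => ?_⟩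
  · exact (ℓ K).continuous_of_finiteDimensional.continuousOn.congr (hv K hK)
  · obtain ⟨K, hK, hpK⟩ := exists_element_superset hp
    rw [Finset.singleton_subset_iff] at hpK
    exact (hv K hK (mem_simplex hpK)).trans (hℓ K hK hpK)

namespace Mesh.IsFEFunction

variable {v w : Space d → ℝ}

theorem sub (hv : T.IsFEFunction v) (hw : T.IsFEFunction w) : T.IsFEFunction (v - w) := by
  refine ⟨hv.1.sub hw.1, fun K hK => ?_⟩
  obtain ⟨ℓ, hℓ⟩ := hv.2 K hK
  obtain ⟨ℓ', hℓ'⟩ := hw.2 K hK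
  exact ⟨ℓ - ℓ', fun x hx => by simp [hℓ hx, hℓ' hx]⟩

theorem eq_zero_on_frontier (hv : T.IsFEFunction v)
    (h : ∀ p ∈ T.vertices, p ∈ frontier Ω → v p = 0) : ∀ x ∈ frontier Ω, v x = 0 := by
  intro x hx
  obtain ⟨s, hs, hxs, hsub⟩ := T.boundary x hx
  obtain ⟨K, hK, hsK⟩ := exists_element_superset hs
  obtain ⟨ℓ, hℓ⟩ := hv.2 K hK
  have hvanish : (s : Set (Space d)).EqOn ℓ (AffineMap.const ℝ (Space d) (0 : ℝ)) := fun p hp =>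
    (hℓ (mem_simplex (hsK hp))).symm.trans
      (h p (mem_vertices_of_mem_face hs hp) (hsub (mem_simplex hp)))
  exact (hℓ (simplex_mono hsK hxs)).trans (affineMap_eqOn_convexHull hvanish hxs)

theorem exists_hasGradientAt (hv : T.IsFEFunction v) (hK : K ∈ T.elements) :
    ∃ ℓ : Space d →ᵃ[ℝ] ℝ, (simplex K).EqOn v ℓ ∧
      ∀ x ∈ interior (simplex K), HasGradientAt v (affineGradient ℓ) x := by
  obtain ⟨ℓ, hℓ⟩ := hv.2 K hK
  exact ⟨ℓ, hℓ, fun x hx => hasGradientAt_of_eqOn_affineMap hℓ hx⟩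

end Mesh.IsFEFunction

end Meshes

section WeakDerivatives

variable {d : ℕ} {Ω U : Set (Space d)}

theorem inner_gradient (φ : Space d → ℝ) (x v : Space d) :
    inner ℝ (gradient φ x) v = fderiv ℝ φ x v := by
  rw [← toDual_gradient, InnerProductSpace.toDual_apply_apply]

theorem gradient_apply (φ : Space d → ℝ) (x : Space d) (i : Fin d) :
    gradient φ x i = fderiv ℝ φ x (EuclideanSpace.single i 1) := by
  rw [← inner_gradient, EuclideanSpace.inner_single_right]
  simp

theorem clm_apply_eq_sum_single (F : Space d →L[ℝ] ℝ) (ξ : Space d) :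
    F ξ = ∑ i, ξ i * F (EuclideanSpace.single i 1) := by
  conv_lhs => rw [← (EuclideanSpace.basisFun (Fin d) ℝ).sum_repr ξ, map_sum]
  simp

theorem gradient_gradient_comm {φ : Space d → ℝ} (hφ : ContDiff ℝ ∞ φ) (x : Space d)
    (i j : Fin d) :
    gradient (fun y => gradient φ y j) x i = gradient (fun y => gradient φ y i) x j := by
  have hdiff : DifferentiableAt ℝ (fderiv ℝ φ) x :=
    (hφ.fderiv_right (m := ∞) le_rfl).differentiable (by simp) x
  have hsecond (k l : Fin d) : gradient (fun y => gradient φ y k) x l =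
      fderiv ℝ (fderiv ℝ φ) x (EuclideanSpace.single l 1) (EuclideanSpace.single k 1) := by
    simp only [gradient_apply]
    rw [fderiv_clm_apply hdiff (differentiableAt_const _)]
    simp
  have hsymm : IsSymmSndFDerivAt ℝ φ x :=
    hφ.contDiffAt.isSymmSndFDerivAt (by simpa using WithTop.coe_le_coe.2 (le_top : (2 : ℕ∞) ≤ ⊤))
  rw [hsecond, hsecond]
  exact hsymm _ _

theorem IsTestFunction.mono {φ : Space d → ℝ} (hφ : IsTestFunction U φ) (hU : U ⊆ Ω) :
    IsTestFunction Ω φ :=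
  ⟨hφ.1, hφ.2.1, hφ.2.2.trans hU⟩

theorem IsTestFunction.memLp {φ : Space d → ℝ} (hφ : IsTestFunction Ω φ) (p : ENNReal) :
    MemLp φ p volume :=
  hφ.1.continuous.memLp_of_hasCompactSupport hφ.2.1

theorem IsTestFunction.eq_zero_of_notMem {φ : Space d → ℝ} (hφ : IsTestFunction Ω φ) {x : Space d}
    (hx : x ∉ Ω) : φ x = 0 :=
  image_eq_zero_of_notMem_tsupport fun h => hx (hφ.2.2 h)

theorem IsTestFunction.partialDeriv {φ : Space d → ℝ} (hφ : IsTestFunction Ω φ) (i : Fin d) :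
    IsTestFunction Ω (fun x => gradient φ x i) := by
  have heq : (fun x => gradient φ x i) =
      (fun F : Space d →L[ℝ] ℝ => F (EuclideanSpace.single i 1)) ∘ fderiv ℝ φ :=
    funext fun x => gradient_apply φ x i
  have hsub : tsupport (fun x => gradient φ x i) ⊆ tsupport φ := by
    rw [heq]
    exact (closure_mono (Function.support_comp_subset (by simp) _)).trans
      (tsupport_fderiv_subset ℝ)
  refine ⟨?_, hφ.2.1.mono' (subset_closure.trans hsub), hsub.trans hφ.2.2⟩
  rw [heq]
  exact (ContinuousLinearMap.apply ℝ ℝ (EuclideanSpace.single i (1 : ℝ))).contDiff.comp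
    (hφ.1.fderiv_right le_rfl)

theorem HasWeakPartial.mono (hΩ : MeasurableSet Ω) (hU : U ⊆ Ω) {i : Fin d}
    {w w' : Space d → ℝ} (h : HasWeakPartial Ω i w w') : HasWeakPartial U i w w' := by
  intro φ hφ
  have hrestrict {v ψ : Space d → ℝ} (hψ : IsTestFunction U ψ) :
      ∫ x in U, v x * ψ x = ∫ x in Ω, v x * ψ x :=
    (setIntegral_eq_of_subset_of_forall_sdiff_eq_zero hΩ hU fun x hx => by
      rw [hψ.eq_zero_of_notMem hx.2, mul_zero]).symm
  rw [hrestrict (hφ.partialDeriv i), hrestrict hφ]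
  exact h φ (hφ.mono hU)

theorem IsH2.mono (hΩ : MeasurableSet Ω) (hU : U ⊆ Ω) {u : Space d → ℝ}
    {Du : Space d → Space d} {H : Space d → Mat d} (hu : IsH2 Ω u Du H) : IsH2 U u Du H := by
  have hle : volume.restrict U ≤ (volume.restrict Ω : Measure (Space d)) :=
    Measure.restrict_mono_set _ hU
  exact ⟨hu.memLp.mono_measure hle, fun i => (hu.memLp_grad i).mono_measure hle,
    fun i j => (hu.memLp_hess i j).mono_measure hle, fun i => (hu.grad i).mono hΩ hU,
    fun i j => (hu.hess i j).mono hΩ hU⟩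

theorem IsH2.ae_isHermitian (hΩ : IsOpen Ω) {u : Space d → ℝ} {Du : Space d → Space d}
    {H : Space d → Mat d} (hu : IsH2 Ω u Du H) :
    ∀ᵐ x ∂(volume.restrict Ω), (H x).IsHermitian := by
  have hcomm (i j : Fin d) {φ : Space d → ℝ} (hφ : IsTestFunction Ω φ) :
      ∫ x in Ω, H x i j * φ x = ∫ x in Ω, H x j i * φ x := by
    have htwice (k l : Fin d) : ∫ x in Ω, H x k l * φ x =
        ∫ x in Ω, u x * gradient (fun y => gradient φ y l) x k := by
      linarith [hu.hess k l φ hφ, hu.grad k _ (hφ.partialDeriv l)]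
    simp only [htwice, gradient_gradient_comm hφ.1 _ i j]
  have hzero (i j : Fin d) : ∀ᵐ x, x ∈ Ω → H x i j - H x j i = 0 := by
    have hmem := (hu.memLp_hess i j).sub (hu.memLp_hess j i)
    refine hΩ.ae_eq_zero_of_integral_contDiff_smul_eq_zero
      (locallyIntegrableOn_of_locallyIntegrable_restrict (hmem.locallyIntegrable one_le_two))
      fun φ hsmooth hcompact hsupp => ?_
    have hφ : IsTestFunction Ω φ := ⟨hsmooth, hcompact, hsupp⟩
    have hint (k l : Fin d) : Integrable (fun x => H x k l * φ x) (volume.restrict Ω) :=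
      (hu.memLp_hess k l).integrable_mul ((hφ.memLp 2).restrict Ω)
    rw [← setIntegral_eq_integral_of_forall_compl_eq_zero (s := Ω) fun x hx => by
      rw [hφ.eq_zero_of_notMem hx, zero_smul]]
    calc ∫ x in Ω, φ x • (H x i j - H x j i)
        = ∫ x in Ω, (H x i j * φ x - H x j i * φ x) := by simp only [smul_eq_mul, mul_comm, mul_sub]
      _ = 0 := by rw [integral_sub (hint i j) (hint j i), hcomm i j hφ, sub_self]
  rw [ae_restrict_iff' hΩ.measurableSet]
  filter_upwards [ae_all_iff.2 fun i => ae_all_iff.2 (hzero i)] with x hx hxΩ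
  ext i j
  rw [Matrix.conjTranspose_apply, star_trivial]
  exact sub_eq_zero.1 (hx j i hxΩ)

end WeakDerivatives

section Mollification

open ContinuousLinearMap
open scoped Convolution

variable {d : ℕ} {Ω U : Set (Space d)} {E : Type*} [NormedAddCommGroup E] [NormedSpace ℝ E]

/-- The convolution `η * w` of a function with a smooth bump function normalised to have unit
mass. -/
def mollify (η : ContDiffBump (0 : Space d)) (w : Space d → E) : Space d → E :=
  η.normed volume ⋆[lsmul ℝ ℝ, volume] w

variable (η : ContDiffBump (0 : Space d))

theorem mollify_apply (w : Space d → E) (x : Space d) :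
    mollify η w x = ∫ y, η.normed volume (x - y) • w y :=
  convolution_lsmul_swap

theorem mollify_indicator_apply (hΩ : MeasurableSet Ω) (w : Space d → E) (x : Space d) :
    mollify η (Ω.indicator w) x = ∫ y in Ω, η.normed volume (x - y) • w y := by
  rw [mollify_apply, ← integral_indicator hΩ]
  exact integral_congr_ae (ae_of_all _ fun y => 
    (Set.indicator_smul_apply Ω (fun y => η.normed volume (x - y)) w y).symm)

theorem integrable_normed_smul {w : Space d → E} (hw : LocallyIntegrable w volume)
    (x : Space d) : Integrable fun y => η.normed volume (x - y) • w y :=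
  (η.hasCompactSupport_normed.convolutionExists_left (lsmul ℝ ℝ : ℝ →L[ℝ] E →L[ℝ] E)
    η.continuous_normed hw x).integrable_swap

theorem normed_sub_eq_zero {x y : Space d} (hy : y ∉ Metric.ball x η.rOut) :
    η.normed volume (x - y) = 0 := by
  rw [← Function.notMem_support, η.support_normed_eq, mem_ball_zero_iff, ← dist_eq_norm, dist_comm]
  exact hy

theorem norm_mollify_le {w : Space d → E} {m : ℝ} {x : Space d}
    (h : ∀ᵐ y ∂(volume : Measure (Space d)), y ∈ Metric.ball x η.rOut → ‖w y‖ ≤ m) :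
    ‖mollify η w x‖ ≤ m := by
  have hmass : ∫ y, η.normed volume (x - y) * m = m := by
    rw [integral_mul_const, integral_sub_left_eq_self (fun y => η.normed volume y) volume x,
      η.integral_normed, one_mul]
  rw [mollify_apply, ← hmass]
  refine norm_integral_le_of_norm_le ((η.integrable_normed.comp_sub_left x).mul_const m) ?_
  filter_upwards [h] with y hy
  rw [norm_smul, Real.norm_of_nonneg (η.nonneg_normed _)]
  by_cases hyb : y ∈ Metric.ball x η.rOut
  · exact mul_le_mul_of_nonneg_left (hy hyb) (η.nonneg_normed _)
  · simp [normed_sub_eq_zero η hyb]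

theorem sum_mul_mollify {ι : Type*} (s : Finset ι) (c : ι → ℝ) {w : ι → Space d → ℝ}
    (hw : ∀ i ∈ s, LocallyIntegrable (w i) volume) (x : Space d) :
    ∑ i ∈ s, c i * mollify η (w i) x = mollify η (fun y => ∑ i ∈ s, c i * w i y) x := by
  have hint : ∀ i ∈ s, Integrable fun y => c i * (η.normed volume (x - y) * w i y) := fun i hi =>
    (integrable_normed_smul η (hw i hi) x).const_mul (c i)
  simp only [mollify_apply, smul_eq_mul, Finset.mul_sum, mul_left_comm _ (c _)]
  rw [integral_finsetSum _ hint]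
  simp only [integral_const_mul]

theorem contDiff_mollify {w : Space d → ℝ} (hw : LocallyIntegrable w volume) :
    ContDiff ℝ ∞ (mollify η w) :=
  η.hasCompactSupport_normed.contDiff_convolution_left _ η.contDiff_normed hw

theorem fderiv_mollify_apply {w : Space d → ℝ} (hw : LocallyIntegrable w volume) (x v : Space d) :
    fderiv ℝ (mollify η w) x v = ∫ y, fderiv ℝ (η.normed volume) (x - y) v * w y := by
  have hsmooth : ContDiff ℝ 1 (η.normed (volume : Measure (Space d))) := η.contDiff_normed
  have hexists := (η.hasCompactSupport_normed.fderiv (𝕜 := ℝ)).convolutionExists_left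
    ((lsmul ℝ ℝ : ℝ →L[ℝ] ℝ →L[ℝ] ℝ).precompL (Space d))
    (hsmooth.continuous_fderiv one_ne_zero) hw x
  have hderiv := η.hasCompactSupport_normed.hasFDerivAt_convolution_left (lsmul ℝ ℝ) hsmooth hw x
  rw [mollify, hderiv.fderiv, convolution_eq_swap,
    ContinuousLinearMap.integral_apply hexists.integrable_swap]
  rfl

theorem isTestFunction_normed_sub {x : Space d} (hx : Metric.closedBall x η.rOut ⊆ Ω) :
    IsTestFunction Ω (fun y => η.normed volume (x - y)) := by
  have htsupport : tsupport (fun y => η.normed volume (x - y)) ⊆ Metric.closedBall x η.rOut :=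
    closure_minimal (fun y hy => Metric.ball_subset_closedBall
      (by_contra fun h => hy (normed_sub_eq_zero η h))) Metric.isClosed_closedBall
  exact ⟨(η.contDiff_normed (n := ⊤)).comp (contDiff_const.sub contDiff_id),
    (isCompact_closedBall x η.rOut).of_isClosed_subset (isClosed_tsupport _) htsupport,
    htsupport.trans hx⟩

theorem gradient_normed_sub_apply (x y : Space d) (i : Fin d) :
    gradient (fun y => η.normed volume (x - y)) y i =
      -fderiv ℝ (η.normed volume) (x - y) (EuclideanSpace.single i 1) := by
  have hdiff : DifferentiableAt ℝ (η.normed (volume : Measure (Space d))) (x - y) :=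
    (η.contDiff_normed (n := 1)).differentiable one_ne_zero _
  have hcomp : HasFDerivAt (fun y => η.normed volume (x - y))
      (-fderiv ℝ (η.normed volume) (x - y)) y :=
    (hdiff.hasFDerivAt.comp y ((hasFDerivAt_id y).const_sub x)).congr_fderiv (by simp)
  rw [gradient_apply, hcomp.fderiv, neg_apply]

theorem fderiv_mollify_single (hΩ : MeasurableSet Ω) {w w' : Space d → ℝ} {i : Fin d}
    (hw : LocallyIntegrable (Ω.indicator w) volume) (h : HasWeakPartial Ω i w w') {x : Space d}
    (hx : Metric.closedBall x η.rOut ⊆ Ω) :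
    fderiv ℝ (mollify η (Ω.indicator w)) x (EuclideanSpace.single i 1) =
      mollify η (Ω.indicator w') x := by
  have hweak := h _ (isTestFunction_normed_sub η hx)
  simp only [gradient_normed_sub_apply, mul_neg, integral_neg, neg_inj] at hweak
  rw [fderiv_mollify_apply η hw, mollify_indicator_apply η hΩ]
  simp only [smul_eq_mul, mul_comm _ (w' _), ← hweak]
  rw [← integral_indicator hΩ]
  refine integral_congr_ae (ae_of_all _ fun y => ?_)
  by_cases hy : y ∈ Ω <;> simp [hy, mul_comm]

theorem hasDerivAt_mollify_line (hΩ : MeasurableSet Ω) {w : Space d → ℝ}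
    {w' : Fin d → Space d → ℝ} (hw : LocallyIntegrable (Ω.indicator w) volume)
    (h : ∀ i, HasWeakPartial Ω i w (w' i)) {x ξ : Space d} {t : ℝ}
    (hx : Metric.closedBall (x + t • ξ) η.rOut ⊆ Ω) :
    HasDerivAt (fun t : ℝ => mollify η (Ω.indicator w) (x + t • ξ))
      (∑ i, ξ i * mollify η (Ω.indicator (w' i)) (x + t • ξ)) t := by
  have hline : HasDerivAt (fun t : ℝ => x + t • ξ) ξ t := by
    simpa using ((hasDerivAt_id t).smul_const ξ).const_add x
  have hderiv := ((contDiff_mollify η hw).differentiable (by simp)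
    (x + t • ξ)).hasFDerivAt.comp_hasDerivAt t hline
  refine hderiv.congr_deriv ?_
  rw [clm_apply_eq_sum_single]
  simp only [fderiv_mollify_single η hΩ hw (h _) hx]

/-- Bump functions shrinking to the origin. -/
def bumpSeq (d : ℕ) (n : ℕ) : ContDiffBump (0 : Space d) where
  rIn := 1 / ((n : ℝ) + 1)
  rOut := 2 / ((n : ℝ) + 1)
  rIn_pos := by positivity
  rIn_lt_rOut := by gcongr; norm_num

theorem tendsto_bumpSeq_rOut (d : ℕ) : Tendsto (fun n => (bumpSeq d n).rOut) atTop (𝓝 0) := by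
  simpa [bumpSeq, div_eq_mul_inv] using
    (tendsto_one_div_add_atTop_nhds_zero_nat (𝕜 := ℝ)).const_mul 2

theorem ae_tendsto_mollify_bumpSeq [CompleteSpace E] {w : Space d → E}
    (hw : LocallyIntegrable w volume) :
    ∀ᵐ x, Tendsto (fun n => mollify (bumpSeq d n) w x) atTop (𝓝 (w x)) :=
  ContDiffBump.ae_convolution_tendsto_right_of_locallyIntegrable (K := 2)
    (tendsto_bumpSeq_rOut d)
    (Eventually.of_forall fun n => by simp [bumpSeq, div_eq_mul_inv]) hw

theorem tendsto_mollify_bumpSeq_of_continuousOn {u : Space d → ℝ} (hU : IsOpen U)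
    (hu : ContinuousOn u U) {x : Space d} (hx : x ∈ U) :
    Tendsto (fun n => mollify (bumpSeq d n) (U.indicator u) x) atTop (𝓝 (u x)) := by
  have heq : U.indicator u =ᶠ[𝓝 x] u :=
    eventually_of_mem (hU.mem_nhds hx) fun y hy => Set.indicator_of_mem hy u
  have hcont : ContinuousAt (U.indicator u) x := (hu.continuousAt (hU.mem_nhds hx)).congr heq.symm
  have hmeas : AEStronglyMeasurable (U.indicator u) volume :=
    (aestronglyMeasurable_indicator_iff hU.measurableSet).2
      (hu.aestronglyMeasurable hU.measurableSet)
  rw [← heq.self_of_nhds]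
  exact ContDiffBump.convolution_tendsto_right (tendsto_bumpSeq_rOut d)
    (Eventually.of_forall fun _ => hmeas) (hcont.tendsto.comp tendsto_snd) tendsto_const_nhds

end Mollification

section Taylor

theorem abs_sub_sub_deriv_le {h h' h'' : ℝ → ℝ} {B : ℝ}
    (hh : ∀ t ∈ Set.Icc (0 : ℝ) 1, HasDerivAt h (h' t) t)
    (hh' : ∀ t ∈ Set.Icc (0 : ℝ) 1, HasDerivAt h' (h'' t) t)
    (hB : ∀ t ∈ Set.Icc (0 : ℝ) 1, |h'' t| ≤ B) : |h 1 - h 0 - h' 0| ≤ B / 2 := by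
  have hfirst : ∀ t ∈ Set.Icc (0 : ℝ) 1, ‖h' t - h' 0‖ ≤ B * t := fun t ht =>
    image_norm_le_of_norm_deriv_right_le_deriv_boundary (f := fun t => h' t - h' 0)
      (fun s hs => ((hh' s hs).sub_const _).continuousAt.continuousWithinAt)
      (fun s hs => ((hh' s ⟨hs.1, hs.2.le⟩).sub_const _).hasDerivWithinAt) (by simp)
      (fun s => by simpa using (hasDerivAt_id s).const_mul B)
      (fun s hs => hB s ⟨hs.1, hs.2.le⟩) ht
  have hremainder : ∀ t ∈ Set.Icc (0 : ℝ) 1,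
      HasDerivAt (fun t => h t - h 0 - h' 0 * t) (h' t - h' 0) t := fun t ht =>
    (((hh t ht).sub_const (h 0)).sub ((hasDerivAt_id t).const_mul (h' 0))).congr_deriv (by
      rw [mul_one])
  have hsecond := image_norm_le_of_norm_deriv_right_le_deriv_boundary
    (B := fun t => B / 2 * t ^ 2) (B' := fun t => B * t)
    (fun t ht => (hremainder t ht).continuousAt.continuousWithinAt)
    (fun t ht => (hremainder t ⟨ht.1, ht.2.le⟩).hasDerivWithinAt) (by simp)
    (fun t => ((hasDerivAt_pow 2 t).const_mul (B / 2)).congr_deriv (by norm_num; ring))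
    (fun t ht => hfirst t ⟨ht.1, ht.2.le⟩) (Set.right_mem_Icc.2 zero_le_one)
  simpa using hsecond

variable {d : ℕ} {U : Set (Space d)} {u : Space d → ℝ} {Du : Space d → Space d}
  {H : Space d → Mat d}

theorem locallyIntegrable_indicator (hU : MeasurableSet U) {w : Space d → ℝ}
    (hw : MemLp w 2 (volume.restrict U)) : LocallyIntegrable (U.indicator w) volume :=
  ((memLp_indicator_iff_restrict hU).2 hw).locallyIntegrable one_le_two

theorem IsH2.abs_sum_mollify_hess_le (hU : MeasurableSet U) (hu : IsH2 U u Du H)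
    (η : ContDiffBump (0 : Space d)) {x ξ : Space d} {m : ℝ}
    (hm : ∀ᵐ y ∂(volume.restrict U), |quad (H y) ξ| ≤ m)
    (hx : Metric.closedBall x η.rOut ⊆ U) :
    |∑ i, ξ i * ∑ j, ξ j * mollify η (U.indicator fun y => H y i j) x| ≤ m := by
  have hsum : ∑ i, ξ i * ∑ j, ξ j * mollify η (U.indicator fun y => H y i j) x =
      mollify η (fun y => ∑ p : Fin d × Fin d,
        ξ p.1 * ξ p.2 * U.indicator (fun y => H y p.1 p.2) y) x := by
    rw [← sum_mul_mollify η _ _ fun p _ => locallyIntegrable_indicator hU (hu.memLp_hess p.1 p.2)]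
    simp only [Fintype.sum_prod_type, Finset.mul_sum, mul_assoc]
  rw [hsum, ← Real.norm_eq_abs]
  refine norm_mollify_le η ?_
  filter_upwards [(ae_restrict_iff' hU).1 hm] with y hy hyx
  have hyU : y ∈ U := hx (Metric.ball_subset_closedBall hyx)
  simpa [Fintype.sum_prod_type, hyU, quad_eq_sum] using hy hyU

theorem IsH2.abs_taylor_mollify_le (hU : MeasurableSet U) (hu : IsH2 U u Du H)
    (η : ContDiffBump (0 : Space d)) {x ξ : Space d} {m : ℝ}
    (hm : ∀ᵐ y ∂(volume.restrict U), |quad (H y) ξ| ≤ m)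
    (hx : ∀ t ∈ Set.Icc (0 : ℝ) 1, Metric.closedBall (x + t • ξ) η.rOut ⊆ U) :
    |mollify η (U.indicator u) (x + ξ) - mollify η (U.indicator u) x -
      ∑ i, ξ i * mollify η (U.indicator fun y => Du y i) x| ≤ m / 2 := by
  have htaylor := abs_sub_sub_deriv_le
    (fun t ht => hasDerivAt_mollify_line η hU (locallyIntegrable_indicator hU hu.memLp) hu.grad
      (hx t ht))
    (fun t ht => HasDerivAt.fun_sum (u := Finset.univ) fun i _ =>
      (hasDerivAt_mollify_line η hU (locallyIntegrable_indicator hU (hu.memLp_grad i)) (hu.hess i)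
        (hx t ht)).const_mul (ξ i))
    (fun t ht => hu.abs_sum_mollify_hess_le hU η hm (hx t ht))
  simpa using htaylor

theorem eventually_closedBall_subset (hU : IsOpen U) (hconv : Convex ℝ U) {x y : Space d}
    (hx : x ∈ U) (hy : y ∈ U) :
    ∀ᶠ n in atTop, ∀ t ∈ Set.Icc (0 : ℝ) 1,
      Metric.closedBall (x + t • (y - x)) (bumpSeq d n).rOut ⊆ U := by
  have hcompact : IsCompact (segment ℝ x y) := by
    rw [segment_eq_image']
    exact isCompact_Icc.image (by fun_prop)
  obtain ⟨ε, hε, hthick⟩ := hcompact.exists_cthickening_subset_open hU (hconv.segment_subset hx hy)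
  filter_upwards [(tendsto_bumpSeq_rOut d).eventually (gt_mem_nhds hε)] with n hn t ht
  refine (Metric.closedBall_subset_closedBall hn.le).trans
    ((Metric.closedBall_subset_cthickening ?_ ε).trans hthick)
  rw [segment_eq_image']
  exact ⟨t, ht, rfl⟩

theorem IsH2.ae_abs_taylor_le (hU : IsOpen U) (hconv : Convex ℝ U) (hu : IsH2 U u Du H)
    (hcont : ContinuousOn u (closure U)) {q : Space d → ℝ} (hqc : Continuous q)
    (hq : ∀ᵐ x ∂(volume.restrict U), ∀ ξ, |quad (H x) ξ| ≤ q ξ) :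
    ∀ᵐ x ∂(volume.restrict U), ∀ y ∈ closure U,
      |u y - u x - inner ℝ (Du x) (y - x)| ≤ q (y - x) / 2 := by
  have hgrad : ∀ᵐ x, ∀ i, Tendsto
      (fun n => mollify (bumpSeq d n) (U.indicator fun y => Du y i) x) atTop
      (𝓝 (U.indicator (fun y => Du y i) x)) := ae_all_iff.2 fun i =>
    ae_tendsto_mollify_bumpSeq (locallyIntegrable_indicator hU.measurableSet (hu.memLp_grad i))
  rw [ae_restrict_iff' hU.measurableSet]
  filter_upwards [hgrad] with x hx hxU
  have hlim {y : Space d} (hy : y ∈ U) :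
      Tendsto (fun n => mollify (bumpSeq d n) (U.indicator u) y) atTop (𝓝 (u y)) :=
    tendsto_mollify_bumpSeq_of_continuousOn hU (hcont.mono subset_closure) hy
  have hopen : ∀ y ∈ U, |u y - u x - inner ℝ (Du x) (y - x)| ≤ q (y - x) / 2 := fun y hy => by
    have hinner : inner ℝ (Du x) (y - x) = ∑ i, (y - x) i * U.indicator (fun y => Du y i) x := by
      simp [PiLp.inner_apply, hxU]
    rw [hinner]
    refine le_of_tendsto (((hlim hy).sub (hlim hxU)).sub
      (tendsto_finsetSum _ fun i _ => (hx i).const_mul ((y - x) i))).abs ?_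
    filter_upwards [eventually_closedBall_subset hU hconv hxU hy] with n hn
    simpa using hu.abs_taylor_mollify_le hU.measurableSet (bumpSeq d n)
      (hq.mono fun _ h => h (y - x)) hn
  intro y hy
  exact le_on_closure hopen ((hcont.sub continuousOn_const).sub (by fun_prop)).abs
    (by fun_prop) hy

end Taylor

section Pullback

open Matrix

variable {d : ℕ} {V K : Finset (Space d)} {F : Space d →ᵃ[ℝ] Space d} {A : Mat d}

/-- The metric tensor `F'ᵀ A F'` that an affine map `F` induces on the reference element from a
metric tensor `A` on the physical element. -/
def pullback (F : Space d →ᵃ[ℝ] Space d) (A : Mat d) : Mat d :=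
  (jacobian F)ᵀ * A * jacobian F

theorem quad_pullback (F : Space d →ᵃ[ℝ] Space d) (A : Mat d) (ξ : Space d) :
    quad (pullback F A) ξ = quad A (F.linear ξ) := by
  have hF : (F.linear ξ).ofLp = jacobian F *ᵥ ξ.ofLp := by
    have hlin : F.linear ξ = toEuclideanLin (jacobian F) ξ := by simp [jacobian]
    rw [hlin]
    rfl
  rw [quad_eq_dotProduct, quad_eq_dotProduct, hF, pullback, ← mulVec_mulVec, ← mulVec_mulVec,
    dotProduct_mulVec, vecMul_transpose]

theorem pullback_smul (F : Space d →ᵃ[ℝ] Space d) (c : ℝ) (A : Mat d) :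
    pullback F (c • A) = c • pullback F A := by
  rw [pullback, pullback, Matrix.mul_smul, Matrix.smul_mul]

theorem pullback_posSemidef (F : Space d →ᵃ[ℝ] Space d) (hA : A.PosSemidef) :
    (pullback F A).PosSemidef := by
  simpa [pullback] using hA.conjTranspose_mul_mul_same (jacobian F)

theorem pullback_posDef (hF : (jacobian F).det ≠ 0) (hA : A.PosDef) : (pullback F A).PosDef := by
  have hunit : IsUnit (jacobian F) := (isUnit_iff_isUnit_det _).2 hF.isUnit
  simpa [pullback] using
    hA.conjTranspose_mul_mul_same (B := jacobian F) (mulVec_injective_of_isUnit hunit)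

theorem det_jacobian (F : Space d →ᵃ[ℝ] Space d) : (jacobian F).det = LinearMap.det F.linear := by
  have hlin : F.linear = toEuclideanLin (jacobian F) := by simp [jacobian]
  conv_rhs => rw [hlin, toEuclideanLin_eq_toLin_orthonormal, LinearMap.det_toLin]

theorem abs_det_jacobian_mul_vol (hF : F '' simplex V = simplex K) :
    |(jacobian F).det| * vol V = vol K := by
  have himage : F '' simplex V = (fun y => y + F 0) '' (F.linear '' simplex V) := by
    rw [Set.image_image]
    exact Set.image_congr fun x _ => congr_fun F.decomp x
  rw [vol, vol, ← hF, himage, measureReal_def, measureReal_def, Set.image_add_right,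
    measure_preimage_add_right, Measure.addHaar_image_linearMap, ENNReal.toReal_mul,
    ENNReal.toReal_ofReal (abs_nonneg _), det_jacobian]

theorem det_pullback (hV : vol V = 1) (hF : F '' simplex V = simplex K) (A : Mat d) :
    (pullback F A).det = vol K ^ 2 * A.det := by
  rw [← abs_det_jacobian_mul_vol hF, hV, mul_one, sq_abs, pullback, det_mul, det_mul,
    det_transpose]
  ring

end Pullback

section LocalInterpolation

open Matrix

variable {d : ℕ} {V K : Finset (Space d)} {F : Space d →ᵃ[ℝ] Space d} {A : Mat d} {c₀ : Space d}
  {r : ℝ}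

theorem linear_le_of_closedBall_subset {E : Type*} [NormedAddCommGroup E] [NormedSpace ℝ E]
    {s : Set E} {c₀ : E} {r m : ℝ} (hr : 0 < r) (hball : Metric.closedBall c₀ r ⊆ s)
    (L : E →ₗ[ℝ] ℝ) (hL : ∀ p ∈ s, ∀ q ∈ s, L (p - q) ≤ m) (ξ : E) : L ξ ≤ m / r * ‖ξ‖ := by
  rcases eq_or_ne ξ 0 with rfl | hξ
  · simp
  have hn : 0 < ‖ξ‖ := norm_pos_iff.2 hξ
  have hp : c₀ + (r / ‖ξ‖) • ξ ∈ s := hball (by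
    rw [mem_closedBall_iff_norm, add_sub_cancel_left, norm_smul,
      Real.norm_of_nonneg (by positivity), div_mul_cancel₀ _ hn.ne'])
  have hbound := hL _ hp c₀ (hball (Metric.mem_closedBall_self hr.le))
  rw [add_sub_cancel_left, map_smul, smul_eq_mul, div_mul_eq_mul_div, div_le_iff₀ hn] at hbound
  rw [div_mul_eq_mul_div, le_div_iff₀ hr]
  linarith

theorem quad_sub_le (hA : A.PosSemidef) (hF : F '' simplex V = simplex K) {x y : Space d}
    (hx : x ∈ simplex K) (hy : y ∈ simplex K) :
    quad A (y - x) ≤ (pullback F A).trace * Metric.diam (simplex V) ^ 2 := by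
  rw [← hF] at hx hy
  obtain ⟨p, hp, rfl⟩ := hx
  obtain ⟨q, hq, rfl⟩ := hy
  have hS := pullback_posSemidef F hA
  have hdiam : ‖q - p‖ ≤ Metric.diam (simplex V) := by
    rw [← dist_eq_norm]
    exact Metric.dist_le_diam_of_mem (isCompact_simplex V).isBounded hq hp
  calc quad A (F q - F p) = quad (pullback F A) (q - p) := by
        rw [quad_pullback]
        exact congrArg _ (F.linearMap_vsub q p).symm
    _ ≤ (pullback F A).trace * ‖q - p‖ ^ 2 := quad_le_trace hS _
    _ ≤ (pullback F A).trace * Metric.diam (simplex V) ^ 2 := by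
        gcongr
        exact hS.trace_nonneg

theorem det_mul_norm_sq_le (hA : A.PosDef) (hJ : (jacobian F).det ≠ 0) {ζ : Space d} {m : ℝ}
    (h : ∀ ξ, inner ℝ ζ (F.linear ξ) ≤ m * ‖ξ‖) :
    (pullback F A).det * ‖ζ‖ ^ 2 ≤ norm2 A * (pullback F A).trace ^ (d - 1) * m ^ 2 := by
  have hS := pullback_posDef hJ hA
  have htr : 0 ≤ (pullback F A).trace ^ (d - 1) := pow_nonneg hS.posSemidef.trace_nonneg _
  rcases eq_or_ne ζ 0 with rfl | hζ
  · have := norm2_nonneg A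
    simpa using by positivity
  obtain ⟨ξ, rfl⟩ : ∃ ξ, F.linear ξ = ζ := by
    rw [det_jacobian] at hJ
    exact (LinearMap.equivOfDetNeZero F.linear hJ).surjective ζ
  set ζ := F.linear ξ
  have hsq : (‖ζ‖ ^ 2) ^ 2 ≤ (m * ‖ξ‖) ^ 2 :=
    pow_le_pow_left₀ (sq_nonneg _) (real_inner_self_eq_norm_sq ζ ▸ h ξ) 2
  have hquad : (pullback F A).det * ‖ξ‖ ^ 2 ≤
      (pullback F A).trace ^ (d - 1) * (norm2 A * ‖ζ‖ ^ 2) := by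
    refine (det_mul_sq_le_trace_pow_mul_quad hS ξ).trans ?_
    rw [quad_pullback]
    exact mul_le_mul_of_nonneg_left (quad_le_norm2 A ζ) htr
  refine le_of_mul_le_mul_right ?_ (by positivity : 0 < ‖ζ‖ ^ 2)
  calc (pullback F A).det * ‖ζ‖ ^ 2 * ‖ζ‖ ^ 2
      = (pullback F A).det * (‖ζ‖ ^ 2) ^ 2 := by ring
    _ ≤ (pullback F A).det * (m * ‖ξ‖) ^ 2 := mul_le_mul_of_nonneg_left hsq hS.det_pos.le
    _ = m ^ 2 * ((pullback F A).det * ‖ξ‖ ^ 2) := by ring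
    _ ≤ m ^ 2 * ((pullback F A).trace ^ (d - 1) * (norm2 A * ‖ζ‖ ^ 2)) := by gcongr
    _ = norm2 A * (pullback F A).trace ^ (d - 1) * m ^ 2 * ‖ζ‖ ^ 2 := by ring

theorem sq_mul_det_le (hd : 1 ≤ d) (hA : A.PosDef) (hJ : (jacobian F).det ≠ 0)
    (hF : F '' simplex V = simplex K) (hr : 0 < r)
    (hball : Metric.closedBall c₀ r ⊆ simplex V) {δ : ℝ} (hδ : Metric.diam (simplex K) ≤ δ) :
    r ^ 2 * (pullback F A).det ≤ norm2 A * (pullback F A).trace ^ (d - 1) * δ ^ 2 := by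
  have hS := pullback_posDef hJ hA
  let ξ : Space d := r • EuclideanSpace.single (⟨0, hd⟩ : Fin d) 1
  have hξ : ‖ξ‖ = r := by simp [ξ, norm_smul, abs_of_pos hr]
  have hp : c₀ + ξ ∈ simplex V := hball (by
    rw [mem_closedBall_iff_norm, add_sub_cancel_left, hξ])
  have hq : c₀ ∈ simplex V := hball (Metric.mem_closedBall_self hr.le)
  have hlin : F.linear ξ = F (c₀ + ξ) - F c₀ := by
    simpa using F.linearMap_vsub (c₀ + ξ) c₀
  have hnorm : ‖F.linear ξ‖ ≤ δ := by
    rw [hlin, ← dist_eq_norm]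
    exact (Metric.dist_le_diam_of_mem (isCompact_simplex K).isBounded
      (hF ▸ Set.mem_image_of_mem F hp) (hF ▸ Set.mem_image_of_mem F hq)).trans hδ
  have htr : 0 ≤ (pullback F A).trace ^ (d - 1) := pow_nonneg hS.posSemidef.trace_nonneg _
  have hnonneg := norm2_nonneg A
  calc r ^ 2 * (pullback F A).det = (pullback F A).det * ‖ξ‖ ^ 2 := by rw [hξ, mul_comm]
    _ ≤ (pullback F A).trace ^ (d - 1) * quad A (F.linear ξ) :=
        quad_pullback F A ξ ▸ det_mul_sq_le_trace_pow_mul_quad hS ξ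
    _ ≤ (pullback F A).trace ^ (d - 1) * (norm2 A * ‖F.linear ξ‖ ^ 2) := by
        gcongr
        exact quad_le_norm2 A _
    _ ≤ (pullback F A).trace ^ (d - 1) * (norm2 A * δ ^ 2) := by gcongr
    _ = norm2 A * (pullback F A).trace ^ (d - 1) * δ ^ 2 := by ring

variable {u : Space d → ℝ} {g x : Space d} {c : ℝ} {ℓ : Space d →ᵃ[ℝ] ℝ}

/-- If the quadratic Taylor remainder of `u` at `x` is controlled by `c A`, then the linear
interpolant of `u` stays close to the tangent plane at `x`: their difference is affine, so it is
enough to compare them at the vertices. -/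
theorem abs_interpolant_sub_tangent_le (hA : A.PosSemidef) (hF : F '' simplex V = simplex K)
    (hc : 0 ≤ c) (hx : x ∈ simplex K)
    (hT : ∀ y ∈ simplex K, |u y - u x - inner ℝ g (y - x)| ≤ c * quad A (y - x) / 2)
    (hℓ : (K : Set (Space d)).EqOn ℓ u) {y : Space d} (hy : y ∈ simplex K) :
    |ℓ y - u x - inner ℝ g (y - x)| ≤
      c * ((pullback F A).trace * Metric.diam (simplex V) ^ 2) / 2 := by
  let E : Space d →ᵃ[ℝ] ℝ := ℓ - AffineMap.const ℝ (Space d) (u x - inner ℝ g x) -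
    (innerₗ (Space d) g).toAffineMap
  have hE (z : Space d) : E z = ℓ z - u x - inner ℝ g (z - x) := by
    simp only [E, AffineMap.coe_sub, Pi.sub_apply, AffineMap.const_apply,
      LinearMap.coe_toAffineMap, innerₗ_apply_apply, inner_sub_right]
    ring
  rw [← hE]
  refine abs_affineMap_le_of_mem_convexHull E (fun p hp => ?_) hy
  rw [hE, hℓ hp]
  refine (hT p (mem_simplex hp)).trans ?_
  gcongr
  exact quad_sub_le hA hF hx (mem_simplex hp)

theorem det_mul_sq_interpolant_sub_le (hd : 1 ≤ d) (hA : A.PosDef) (hJ : (jacobian F).det ≠ 0)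
    (hF : F '' simplex V = simplex K) (hr : 0 < r) (hball : Metric.closedBall c₀ r ⊆ simplex V)
    (hc : 0 ≤ c) (hx : x ∈ simplex K)
    (hT : ∀ y ∈ simplex K, |u y - u x - inner ℝ g (y - x)| ≤ c * quad A (y - x) / 2)
    (hℓ : (K : Set (Space d)).EqOn ℓ u) {δ : ℝ} (hδ : Metric.diam (simplex K) ≤ δ) :
    (pullback F A).det * (u x - ℓ x) ^ 2 ≤
      δ ^ 2 * ((c * Metric.diam (simplex V) ^ 2 / r) ^ 2 *
        (norm2 A * (pullback F A).trace ^ (d + 1))) := by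
  set t := (pullback F A).trace
  set D := Metric.diam (simplex V)
  have hvalue : |u x - ℓ x| ≤ c * (t * D ^ 2) / 2 := by
    rw [abs_sub_comm]
    simpa using abs_interpolant_sub_tangent_le hA.posSemidef hF hc hx hT hℓ hx
  have hsq : (u x - ℓ x) ^ 2 ≤ (c * (t * D ^ 2)) ^ 2 := by
    rw [← sq_abs]
    refine pow_le_pow_left₀ (abs_nonneg _) (hvalue.trans (half_le_self ?_)) 2
    linarith [abs_nonneg (u x - ℓ x)]
  have hdet := sq_mul_det_le hd hA hJ hF hr hball hδ
  have hpow : t ^ (d + 1) = t ^ (d - 1) * t ^ 2 := by rw [← pow_add]; congr 1; lia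
  have hS := (pullback_posDef hJ hA).det_pos
  rw [hpow]
  refine le_of_mul_le_mul_left ?_ (by positivity : 0 < r ^ 2)
  calc r ^ 2 * ((pullback F A).det * (u x - ℓ x) ^ 2)
      ≤ r ^ 2 * ((pullback F A).det * (c * (t * D ^ 2)) ^ 2) := by gcongr
    _ = r ^ 2 * (pullback F A).det * (c * (t * D ^ 2)) ^ 2 := by ring
    _ ≤ norm2 A * t ^ (d - 1) * δ ^ 2 * (c * (t * D ^ 2)) ^ 2 := by gcongr
    _ = r ^ 2 * (δ ^ 2 * ((c * D ^ 2 / r) ^ 2 * (norm2 A * (t ^ (d - 1) * t ^ 2)))) := by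
        field_simp

theorem det_mul_sq_gradient_sub_le (hd : 1 ≤ d) (hA : A.PosDef) (hJ : (jacobian F).det ≠ 0)
    (hF : F '' simplex V = simplex K) (hr : 0 < r) (hball : Metric.closedBall c₀ r ⊆ simplex V)
    (hc : 0 ≤ c) (hx : x ∈ simplex K)
    (hT : ∀ y ∈ simplex K, |u y - u x - inner ℝ g (y - x)| ≤ c * quad A (y - x) / 2)
    (hℓ : (K : Set (Space d)).EqOn ℓ u) :
    (pullback F A).det * ‖g - affineGradient ℓ‖ ^ 2 ≤
      (c * Metric.diam (simplex V) ^ 2 / r) ^ 2 * (norm2 A * (pullback F A).trace ^ (d + 1)) := by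
  set t := (pullback F A).trace
  set D := Metric.diam (simplex V)
  have hdiff : ∀ p ∈ simplex V, ∀ q ∈ simplex V,
      inner ℝ (g - affineGradient ℓ) (F.linear (p - q)) ≤ c * (t * D ^ 2) := fun p hp q hq => by
    have htangent {z : Space d} (hz : z ∈ simplex V) := abs_le.1
      (abs_interpolant_sub_tangent_le hA.posSemidef hF hc hx hT hℓ (hF ▸ Set.mem_image_of_mem F hz))
    have hlin : F.linear (p - q) = F p - F q := F.linearMap_vsub p q
    have hpq : inner ℝ g (F p - F q) = inner ℝ g (F p - x) - inner ℝ g (F q - x) := by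
      rw [← inner_sub_right, sub_sub_sub_cancel_right]
    rw [hlin, inner_sub_left, ← affineMap_sub_apply_eq_inner, hpq]
    linarith [(htangent hp).1, (htangent hq).2]
  have hpow : t ^ (d + 1) = t ^ (d - 1) * t ^ 2 := by rw [← pow_add]; congr 1; lia
  refine (det_mul_norm_sq_le hA hJ (linear_le_of_closedBall_subset hr hball
    ((innerₗ (Space d) (g - affineGradient ℓ)).comp F.linear) hdiff)).trans (le_of_eq ?_)
  rw [hpow]
  ring

end LocalInterpolation

section LipschitzGlueing

variable {E F : Type*} [NormedAddCommGroup E] [NormedSpace ℝ E]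

theorem exists_frequently_mem_of_finite_cover {ι X : Type*} [Finite ι] {C : ι → Set X}
    (hcov : ∀ x, ∃ i, x ∈ C i) (l : Filter X) [l.NeBot] : ∃ i, ∃ᶠ x in l, x ∈ C i := by
  by_contra! hcon
  obtain ⟨x, hx⟩ := (eventually_all.2 hcon).exists
  obtain ⟨i, hi⟩ := hcov x
  exact hx i hi

theorem lipschitzWith_of_finite_closed_cover {ι : Type*} [Finite ι] {f : E → ℝ} {M : ℝ≥0}
    (hf : Continuous f) {C : ι → Set E} (hC : ∀ i, IsClosed (C i)) (hcov : ∀ x, ∃ i, x ∈ C i)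
    (h : ∀ i, LipschitzOnWith M f (C i)) : LipschitzWith M f := by
  refine LipschitzWith.of_le_add_mul M fun b a => ?_
  have hline : Continuous (AffineMap.lineMap a b : ℝ → E) := AffineMap.lineMap_continuous
  have hslope : ∀ t ∈ Set.Ico (0 : ℝ) 1, ∀ r, M * dist b a < r →
      ∃ᶠ z in 𝓝[>] t, slope (fun s => f (AffineMap.lineMap a b s)) t z < r := by
    intro t _ r hr
    obtain ⟨i, hi⟩ := exists_frequently_mem_of_finite_cover
      (fun z : ℝ => hcov (AffineMap.lineMap a b z)) (𝓝[>] t)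
    have hti : AffineMap.lineMap a b t ∈ C i := (hC i).mem_of_frequently_of_tendsto hi
      ((hline.tendsto t).mono_left nhdsWithin_le_nhds)
    refine (hi.and_eventually self_mem_nhdsWithin).mono ?_
    rintro z ⟨hz, hzt : t < z⟩
    have hpos : 0 < z - t := sub_pos.2 hzt
    refine lt_of_le_of_lt ?_ hr
    rw [slope_def_field, div_le_iff₀ hpos]
    refine (le_abs_self _).trans (((h i).dist_le_mul _ hz _ hti).trans_eq ?_)
    rw [dist_lineMap_lineMap, Real.dist_eq, abs_of_pos hpos, dist_comm a b]
    ring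
  have hbound := image_le_of_liminf_slope_right_le_deriv_boundary
    (f := fun t : ℝ => f (AffineMap.lineMap a b t)) (a := 0) (b := 1)
    (B := fun t => f a + M * dist b a * t) (B' := fun _ => M * dist b a)
    (hf.comp hline).continuousOn (by simp) (by fun_prop)
    (fun t _ => by
      simpa using (((hasDerivAt_id t).const_mul (M * dist b a)).const_add (f a)).hasDerivWithinAt)
    hslope (Set.right_mem_Icc.2 zero_le_one)
  simpa using hbound

end LipschitzGlueing

section SoftThreshold

/-- Soft thresholding, which moves `s` towards `0` by `ε`. It makes a function vanish near its zero
set and keeps its gradient where the function is larger than `ε`. -/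
def softThreshold (ε s : ℝ) : ℝ := s - max (-ε) (min ε s)

variable {ε s : ℝ}

theorem lipschitzWith_softThreshold (ε : ℝ) : LipschitzWith 2 (softThreshold ε) := by
  have h := LipschitzWith.id.sub ((LipschitzWith.id (α := ℝ)).const_min ε |>.const_max (-ε))
  rwa [one_add_one_eq_two] at h

theorem softThreshold_of_abs_le (h : |s| ≤ ε) : softThreshold ε s = 0 := by
  obtain ⟨hneg, hpos⟩ := abs_le.1 h
  rw [softThreshold, min_eq_right hpos, max_eq_right hneg, sub_self]

theorem softThreshold_of_le (hε : 0 ≤ ε) (h : ε ≤ s) : softThreshold ε s = s - ε := by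
  rw [softThreshold, min_eq_left h, max_eq_right (by linarith)]

theorem softThreshold_of_le_neg (hε : 0 ≤ ε) (h : s ≤ -ε) : softThreshold ε s = s + ε := by
  rw [softThreshold, min_eq_right (by linarith), max_eq_left h, sub_neg_eq_add]

theorem abs_softThreshold_sub_le (hε : 0 ≤ ε) (s : ℝ) : |softThreshold ε s - s| ≤ ε := by
  rw [softThreshold, sub_sub_cancel_left, abs_neg, abs_le]
  exact ⟨le_max_left _ _, max_le (by linarith) (min_le_left _ _)⟩

theorem tsupport_softThreshold_subset {X : Type*} [TopologicalSpace X] {Ω : Set X} {V : X → ℝ}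
    (hε : 0 < ε) (hV : Continuous V) (hVΩ : ∀ x ∉ Ω, V x = 0) :
    tsupport (fun x => softThreshold ε (V x)) ⊆ Ω := by
  have hsub : tsupport (fun x => softThreshold ε (V x)) ⊆ {x | ε ≤ |V x|} :=
    closure_minimal (fun x hx => not_lt.1 fun hlt => hx (softThreshold_of_abs_le hlt.le))
      (isClosed_le continuous_const hV.abs)
  refine hsub.trans fun x (hx : ε ≤ |V x|) => by_contra fun hxΩ => ?_
  rw [hVΩ x hxΩ, abs_zero] at hx
  exact hε.not_ge hx

theorem eventually_hasGradientAt_softThreshold {E : Type*} [NormedAddCommGroup E]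
    [InnerProductSpace ℝ E] [CompleteSpace E] {V : E → ℝ} {g x : E} (hV : HasGradientAt V g x)
    (hzero : V x = 0 → g = 0) :
    ∀ᶠ ε in 𝓝[>] (0 : ℝ), HasGradientAt (fun y => softThreshold ε (V y)) g x := by
  have hcont : ContinuousAt V x := hV.differentiableAt.continuousAt
  rcases lt_trichotomy (V x) 0 with hx | hx | hx
  · filter_upwards [self_mem_nhdsWithin,
      nhdsWithin_le_nhds (gt_mem_nhds (neg_pos.2 hx))] with ε (hε : 0 < ε) hεx
    have hshift : HasGradientAt (fun y => V y + ε) g x :=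
      hasGradientAt_iff_hasFDerivAt.2 (hV.hasFDerivAt.add_const ε)
    refine hshift.congr_of_eventuallyEq ?_
    filter_upwards [hcont.eventually (gt_mem_nhds (lt_neg_of_lt_neg hεx))] with y hy
    exact softThreshold_of_le_neg hε.le hy.le
  · filter_upwards [self_mem_nhdsWithin] with ε (hε : 0 < ε)
    rw [hzero hx]
    refine (hasGradientAt_const x (0 : ℝ)).congr_of_eventuallyEq ?_
    have hlt : |V x| < ε := by rwa [hx, abs_zero]
    filter_upwards [hcont.abs.eventually (gt_mem_nhds hlt)] with y hy
    exact softThreshold_of_abs_le hy.le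
  · filter_upwards [self_mem_nhdsWithin, nhdsWithin_le_nhds (gt_mem_nhds hx)] with
      ε (hε : 0 < ε) hεx
    have hshift : HasGradientAt (fun y => V y - ε) g x :=
      hasGradientAt_iff_hasFDerivAt.2 (hV.hasFDerivAt.sub_const ε)
    refine hshift.congr_of_eventuallyEq ?_
    filter_upwards [hcont.eventually (lt_mem_nhds hεx)] with y hy
    exact softThreshold_of_le hε.le hy.le

end SoftThreshold

section Approximation

variable {d : ℕ} {Ω : Set (Space d)} {W : Space d → ℝ} {M : ℝ≥0}

theorem norm_gradient_le (hW : LipschitzWith M W) (x : Space d) : ‖gradient W x‖ ≤ M := by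
  rw [← (InnerProductSpace.toDual ℝ (Space d)).norm_map, toDual_gradient]
  exact norm_fderiv_le_of_lipschitz ℝ hW

theorem measurable_gradient (W : Space d → ℝ) : Measurable (gradient W) :=
  (InnerProductSpace.toDual ℝ (Space d)).symm.continuous.measurable.comp (measurable_fderiv ℝ W)

theorem locallyIntegrable_gradient (hW : LipschitzWith M W) :
    LocallyIntegrable (gradient W) volume := by
  refine (locallyIntegrable_const (M : ℝ)).mono (measurable_gradient W).aestronglyMeasurable
    (ae_of_all _ fun x => ?_)
  simpa using norm_gradient_le hW x

theorem hasWeakPartial_gradient (hW : LipschitzWith M W) (i : Fin d) :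
    HasWeakPartial Set.univ i W (fun x => gradient W x i) := by
  rintro φ ⟨hφ, hφc, -⟩
  obtain ⟨D, hD⟩ :=
    (hφ.of_le (by simp) : ContDiff ℝ 1 φ).lipschitzWith_of_hasCompactSupport hφc one_ne_zero
  have hparts := LipschitzWith.integral_lineDeriv_mul_eq (μ := volume) hW hD hφc
    (EuclideanSpace.single i 1)
  have hleft : ∫ x, lineDeriv ℝ W x (EuclideanSpace.single i 1) * φ x =
      ∫ x, gradient W x i * φ x := by
    refine integral_congr_ae ?_
    filter_upwards [hW.ae_differentiableAt] with x hx
    rw [hx.lineDeriv_eq_fderiv, gradient_apply]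
  have hright : ∫ x, lineDeriv ℝ φ x (-EuclideanSpace.single i 1) * W x =
      -∫ x, W x * gradient φ x i := by
    rw [← integral_neg]
    refine integral_congr_ae (ae_of_all _ fun x => ?_)
    dsimp only
    rw [(hφ.differentiable (by simp) x).lineDeriv_eq_fderiv, gradient_apply, map_neg]
    ring
  rw [Measure.restrict_univ, ← hleft, hparts, hright, neg_neg]

theorem gradient_mollify (hW : LipschitzWith M W) (η : ContDiffBump (0 : Space d)) (x : Space d) :
    gradient (mollify η W) x = mollify η (gradient W) x := by
  ext i
  have hpartial := fderiv_mollify_single η MeasurableSet.univ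
    (by simpa using hW.continuous.locallyIntegrable) (hasWeakPartial_gradient hW i)
    (Set.subset_univ (Metric.closedBall x η.rOut))
  rw [Set.indicator_univ, Set.indicator_univ, ← gradient_apply] at hpartial
  rw [hpartial, mollify_apply, mollify_apply]
  simpa using (EuclideanSpace.proj (𝕜 := ℝ) i).integral_comp_comm
    (integrable_normed_smul η (locallyIntegrable_gradient hW) x)

theorem support_mollify_subset (η : ContDiffBump (0 : Space d)) (W : Space d → ℝ) :
    Function.support (mollify η W) ⊆ Metric.cthickening η.rOut (tsupport W) := by
  refine fun x hx => by_contra fun hxW => hx (norm_le_zero_iff.1 ?_)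
  refine norm_mollify_le η (ae_of_all _ fun y hy => ?_)
  have hyW : y ∉ tsupport W := fun h =>
    hxW (Metric.mem_cthickening_of_dist_le x y _ _ h (by
      rw [dist_comm]
      exact (Metric.mem_ball.1 hy).le))
  rw [image_eq_zero_of_notMem_tsupport hyW, norm_zero]

/-- Convergence of the functions `φ n`, with gradients `Dφ n`, to `v`, with gradient `Dv`, almost
everywhere in `Ω` with a common square integrable majorant. Both sides of the weak equation pass to
the limit under this mode of convergence, by dominated convergence. -/
structure DominatedTendsto (Ω : Set (Space d)) (φ : ℕ → Space d → ℝ)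
    (Dφ : ℕ → Space d → Space d) (v : Space d → ℝ) (Dv : Space d → Space d) : Prop where
  aestronglyMeasurable : ∀ n, AEStronglyMeasurable (φ n) (volume.restrict Ω)
  aestronglyMeasurable_grad : ∀ n, AEStronglyMeasurable (Dφ n) (volume.restrict Ω)
  exists_majorant : ∃ m, MemLp m 2 (volume.restrict Ω) ∧
    ∀ n, ∀ᵐ x ∂(volume.restrict Ω), |φ n x| ≤ m x ∧ ‖Dφ n x‖ ≤ m x
  tendsto : ∀ᵐ x ∂(volume.restrict Ω), Tendsto (fun n => φ n x) atTop (𝓝 (v x))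
  tendsto_grad : ∀ᵐ x ∂(volume.restrict Ω), Tendsto (fun n => Dφ n x) atTop (𝓝 (Dv x))

theorem exists_const_majorant (hΩ : Bornology.IsBounded Ω) {φ : ℕ → Space d → ℝ}
    {Dφ : ℕ → Space d → Space d} {B C : ℝ} (hφ : ∀ n x, |φ n x| ≤ B) (hDφ : ∀ n x, ‖Dφ n x‖ ≤ C) :
    ∃ m, MemLp m 2 (volume.restrict Ω) ∧
      ∀ n, ∀ᵐ x ∂(volume.restrict Ω), |φ n x| ≤ m x ∧ ‖Dφ n x‖ ≤ m x := by
  have : IsFiniteMeasure (volume.restrict Ω) := ⟨by simpa using hΩ.measure_lt_top⟩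
  exact ⟨fun _ => max B C, memLp_const _, fun n => ae_of_all _ fun x =>
    ⟨(hφ n x).trans (le_max_left _ _), (hDφ n x).trans (le_max_right _ _)⟩⟩

theorem ae_indicator_eventuallyEq (hΩ : IsOpen Ω) (v : Space d → ℝ) :
    ∀ᵐ x ∂(volume.restrict Ω), Ω.indicator v =ᶠ[𝓝 x] v := by
  filter_upwards [ae_restrict_mem hΩ.measurableSet] with x hx
  exact (Set.eqOn_indicator (s := Ω) (f := v)).eventuallyEq_of_mem (hΩ.mem_nhds hx)

theorem exists_testFunctions_tendsto (hΩ : IsOpen Ω) (hbdd : Bornology.IsBounded Ω)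
    (hW : LipschitzWith M W) (hc : HasCompactSupport W) (hs : tsupport W ⊆ Ω) :
    ∃ φ : ℕ → Space d → ℝ, (∀ n, IsTestFunction Ω (φ n)) ∧
      DominatedTendsto Ω φ (fun n => gradient (φ n)) W (gradient W) := by
  obtain ⟨ε, hε, hthick⟩ := hc.isCompact.exists_cthickening_subset_open hΩ hs
  obtain ⟨n₀, hn₀⟩ := eventually_atTop.1 ((tendsto_bumpSeq_rOut d).eventually (gt_mem_nhds hε))
  have hint : LocallyIntegrable W volume := hW.continuous.locallyIntegrable
  have hgint := locallyIntegrable_gradient hW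
  obtain ⟨B, hB⟩ := hc.exists_bound_of_continuous hW.continuous
  have htest : ∀ n, IsTestFunction Ω (mollify (bumpSeq d (n + n₀)) W) := fun n => by
    have hsupp : Function.support (mollify (bumpSeq d (n + n₀)) W) ⊆
        Metric.cthickening ε (tsupport W) :=
      (support_mollify_subset _ W).trans
        (Metric.cthickening_mono (hn₀ (n + n₀) (Nat.le_add_left _ _)).le _)
    exact ⟨contDiff_mollify _ hint,
      HasCompactSupport.of_support_subset_isCompact hc.isCompact.cthickening hsupp,
      (closure_minimal hsupp Metric.isClosed_cthickening).trans hthick⟩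
  refine ⟨fun n => mollify (bumpSeq d (n + n₀)) W, htest, ?_, ?_, ?_, ?_, ?_⟩
  · exact fun n => (htest n).1.continuous.aestronglyMeasurable
  · exact fun n => (measurable_gradient _).aestronglyMeasurable
  · refine exists_const_majorant hbdd (B := B) (C := M)
      (fun n x => norm_mollify_le _ (ae_of_all _ fun y _ => hB y)) fun n x => ?_
    rw [gradient_mollify hW]
    exact norm_mollify_le _ (ae_of_all _ fun y _ => norm_gradient_le hW y)
  · filter_upwards [ae_restrict_of_ae (ae_tendsto_mollify_bumpSeq hint)] with x hx
    exact hx.comp (tendsto_add_atTop_nat n₀)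
  · simp only [gradient_mollify hW]
    filter_upwards [ae_restrict_of_ae (ae_tendsto_mollify_bumpSeq hgint)] with x hx
    exact hx.comp (tendsto_add_atTop_nat n₀)

theorem exists_compactSupport_tendsto (hbdd : Bornology.IsBounded Ω) (hW : LipschitzWith M W)
    (hWΩ : ∀ x ∉ Ω, W x = 0)
    (hzero : ∀ᵐ x ∂(volume.restrict Ω), W x = 0 → gradient W x = 0) :
    ∃ V : ℕ → Space d → ℝ, (∀ n, LipschitzWith (2 * M) (V n) ∧ HasCompactSupport (V n) ∧
      tsupport (V n) ⊆ Ω) ∧ DominatedTendsto Ω V (fun n => gradient (V n)) W (gradient W) := by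
  obtain ⟨ε, -, hε, hε0⟩ := exists_seq_strictAnti_tendsto' (zero_lt_one (α := ℝ))
  have hlip : ∀ n, LipschitzWith (2 * M) fun x => softThreshold (ε n) (W x) := fun n =>
    (lipschitzWith_softThreshold (ε n)).comp hW
  have hsupp : ∀ n, tsupport (fun x => softThreshold (ε n) (W x)) ⊆ Ω := fun n =>
    tsupport_softThreshold_subset (hε n).1 hW.continuous hWΩ
  have hcomp : HasCompactSupport W :=
    HasCompactSupport.of_support_subset_isCompact hbdd.isCompact_closure
      ((Function.support_subset_iff'.2 hWΩ).trans subset_closure)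
  obtain ⟨B, hB⟩ := hcomp.exists_bound_of_continuous hW.continuous
  refine ⟨fun n x => softThreshold (ε n) (W x), fun n => ⟨hlip n,
    hbdd.isCompact_closure.of_isClosed_subset (isClosed_tsupport _)
      ((hsupp n).trans subset_closure),
    hsupp n⟩, fun n => (hlip n).continuous.aestronglyMeasurable,
    fun n => (measurable_gradient _).aestronglyMeasurable, ?_, ?_, ?_⟩
  · refine exists_const_majorant hbdd (B := B + 1) (fun n x => ?_) fun n x =>
      norm_gradient_le (hlip n) x
    have hdist := abs_softThreshold_sub_le (hε n).1.le (W x)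
    have hWx : |W x| ≤ B := hB x
    change |softThreshold (ε n) (W x)| ≤ B + 1
    linarith [abs_sub_abs_le_abs_sub (softThreshold (ε n) (W x)) (W x), (hε n).2]
  · exact ae_of_all _ fun x => tendsto_iff_dist_tendsto_zero.2
      (squeeze_zero (fun _ => dist_nonneg)
        (fun n => abs_softThreshold_sub_le (hε n).1.le (W x)) hε0)
  · have hε0' : Tendsto ε atTop (𝓝[>] 0) :=
      tendsto_nhdsWithin_iff.2 ⟨hε0, Eventually.of_forall fun n => (hε n).1⟩
    filter_upwards [hzero, ae_restrict_of_ae hW.ae_differentiableAt] with x hx hdiff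
    refine tendsto_const_nhds.congr' ?_
    filter_upwards [hε0'.eventually
      (eventually_hasGradientAt_softThreshold hdiff.hasGradientAt hx)] with n hn
    exact hn.gradient.symm

end Approximation

section FEFunctions

variable {d : ℕ} {Ω : Set (Space d)} {T : Mesh Ω} {v : Space d → ℝ}

theorem volume_zeroSet_affineMap {ℓ : Space d →ᵃ[ℝ] ℝ} (h : affineGradient ℓ ≠ 0) :
    volume {x | ℓ x = 0} = 0 := by
  let s : AffineSubspace ℝ (Space d) := (AffineSubspace.mk' (0 : ℝ) ⊥).comap ℓ
  have hs : (s : Set (Space d)) = {x | ℓ x = 0} := by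
    ext x
    simp [s, AffineSubspace.mem_mk']
  rw [← hs]
  refine Measure.addHaar_affineSubspace volume s fun htop => h ?_
  have hzero : ∀ x, ℓ x = 0 := fun x => hs.subset (htop ▸ AffineSubspace.mem_top ℝ _ x)
  refine ext_inner_right ℝ fun ξ => ?_
  simpa [hzero] using (affineMap_sub_apply_eq_inner ℓ ξ 0).symm

theorem lipschitzWith_affineMap (ℓ : Space d →ᵃ[ℝ] ℝ) : LipschitzWith ‖affineGradient ℓ‖₊ ℓ :=
  LipschitzWith.of_dist_le_mul fun x y => by
    rw [Real.dist_eq, affineMap_sub_apply_eq_inner, dist_eq_norm]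
    exact abs_real_inner_le_norm _ _

namespace Mesh.IsFEFunction

theorem exists_lipschitzWith_indicator (hΩ : IsOpen Ω) (hv : T.IsFEFunction v)
    (h0 : ∀ x ∈ frontier Ω, v x = 0) : ∃ M : ℝ≥0, LipschitzWith M (Ω.indicator v) := by
  choose! ℓ hℓ using hv.2
  have hind : (closure Ω).EqOn (Ω.indicator v) v := by
    intro x hx
    by_cases hxΩ : x ∈ Ω
    · exact Set.indicator_of_mem hxΩ v
    · rw [Set.indicator_of_notMem hxΩ, h0 x (hΩ.frontier_eq ▸ ⟨hx, hxΩ⟩)]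
  refine ⟨∑ K ∈ T.elements, ‖affineGradient (ℓ K)‖₊, lipschitzWith_of_finite_closed_cover
    (C := fun o : Option T.elements => o.elim Ωᶜ fun K => simplex (K : Finset (Space d)))
    (continuous_indicator h0 hv.1) ?_ (fun x => ?_) ?_⟩
  · rintro (_ | K)
    exacts [hΩ.isClosed_compl, (isCompact_simplex _).isClosed]
  · by_cases hx : x ∈ Ω
    · obtain ⟨K, hK, hxK⟩ := T.exists_mem_simplex (subset_closure hx)
      exact ⟨some ⟨K, hK⟩, hxK⟩
    · exact ⟨none, hx⟩
  · rintro (_ | ⟨K, hK⟩)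
    · intro x (hx : x ∉ Ω) y (hy : y ∉ Ω)
      simp [hx, hy]
    · have hle : ‖affineGradient (ℓ K)‖₊ ≤ ∑ K ∈ T.elements, ‖affineGradient (ℓ K)‖₊ :=
        Finset.single_le_sum (f := fun K => ‖affineGradient (ℓ K)‖₊) (fun _ _ => zero_le) hK
      intro x hx y hy
      have heq := (hind.mono (simplex_subset_closure hK)).trans (hℓ K hK)
      rw [heq hx, heq hy]
      exact ((lipschitzWith_affineMap (ℓ K)).weaken hle) x y

theorem ae_gradient_eq_zero (hΩ : IsOpen Ω) (hv : T.IsFEFunction v) :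
    ∀ᵐ x ∂(volume.restrict Ω), v x = 0 → gradient v x = 0 := by
  choose! ℓ hℓ using hv.2
  have hnull : ∀ᵐ x ∂(volume.restrict Ω), ∀ K ∈ T.elements,
      ℓ K x = 0 → affineGradient (ℓ K) = 0 := by
    refine ae_restrict_of_ae ((Finset.eventually_all T.elements).2 fun K _ => ?_)
    by_cases hgrad : affineGradient (ℓ K) = 0
    · exact ae_of_all _ fun _ _ => hgrad
    · filter_upwards [measure_eq_zero_iff_ae_notMem.1 (volume_zeroSet_affineMap hgrad)] with
        x hx hzero
      exact absurd hzero hx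
  filter_upwards [hnull, T.ae_exists_mem_interior hΩ] with x hx ⟨K, hK, hxK⟩ hvx
  rw [(hasGradientAt_of_eqOn_affineMap (hℓ K hK) hxK).gradient]
  exact hx K hK (hℓ K hK (interior_subset hxK) ▸ hvx)

end Mesh.IsFEFunction

end FEFunctions

section Poincare

variable {d : ℕ} {Ω : Set (Space d)} {φ : Space d → ℝ}

theorem IsTestFunction.integrable_mul (hφ : IsTestFunction Ω φ) {ψ : Space d → ℝ}
    (hψ : Continuous ψ) : Integrable fun x => ψ x * φ x :=
  (hψ.mul hφ.1.continuous).integrable_of_hasCompactSupport hφ.2.1.mul_left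

theorem IsTestFunction.integrable_coord_mul (hφ : IsTestFunction Ω φ) (i : Fin d) :
    Integrable fun x => x i * (2 * φ x * gradient φ x i) := by
  have hcont : Continuous fun x => x i * gradient φ x i :=
    (EuclideanSpace.proj (𝕜 := ℝ) i).continuous.mul (hφ.partialDeriv i).1.continuous
  exact ((hφ.integrable_mul hcont).const_mul 2).congr (ae_of_all _ fun x => by ring)

theorem IsTestFunction.integral_sq_eq (hφ : IsTestFunction Ω φ) (i : Fin d) :
    ∫ x in Ω, φ x ^ 2 = -∫ x in Ω, x i * (2 * φ x * gradient φ x i) := by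
  have hcoord (x : Space d) :
      HasFDerivAt (fun y : Space d => y i) (EuclideanSpace.proj (𝕜 := ℝ) i) x :=
    (EuclideanSpace.proj (𝕜 := ℝ) i).hasFDerivAt
  have hsq (x : Space d) : HasFDerivAt (fun y => φ y ^ 2) ((2 * φ x) • fderiv ℝ φ x) x := by
    simpa using (hφ.1.differentiable (by simp) x).hasFDerivAt.pow 2
  have hcont := hφ.1.continuous
  have hxφ : Continuous fun x => x i * φ x :=
    (EuclideanSpace.proj (𝕜 := ℝ) i).continuous.mul hcont
  have hparts := integral_mul_fderiv_eq_neg_fderiv_mul_of_integrable (μ := volume)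
    (f := fun x : Space d => x i) (g := fun x => φ x ^ 2) (v := EuclideanSpace.single i 1)
    (by simpa [(hcoord _).fderiv, sq] using hφ.integrable_mul hcont)
    (by simpa [(hsq _).fderiv, ← gradient_apply] using hφ.integrable_coord_mul i)
    (by simpa [sq, mul_assoc] using hφ.integrable_mul hxφ)
    (fun x _ => (hcoord x).differentiableAt) fun x _ => (hsq x).differentiableAt
  simp only [(hcoord _).fderiv, (hsq _).fderiv, FunLike.coe_smul, Pi.smul_apply,
    ← gradient_apply, smul_eq_mul, PiLp.proj_apply, PiLp.single_apply,
    if_true, one_mul] at hparts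
  rw [setIntegral_eq_integral_of_forall_compl_eq_zero fun x hx => by
      rw [hφ.eq_zero_of_notMem hx, zero_pow two_ne_zero],
    setIntegral_eq_integral_of_forall_compl_eq_zero fun x hx => by
      rw [hφ.eq_zero_of_notMem hx, mul_zero, zero_mul, mul_zero], hparts, neg_neg]

theorem IsTestFunction.memLp_gradient (hφ : IsTestFunction Ω φ) (p : ENNReal) :
    MemLp (gradient φ) p volume :=
  MemLp.of_eval_piLp fun i => (hφ.partialDeriv i).memLp p

theorem IsTestFunction.integral_sq_le (hd : 1 ≤ d) {R : ℝ} (hR : ∀ x ∈ Ω, ‖x‖ ≤ R)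
    (hΩ : MeasurableSet Ω) (hφ : IsTestFunction Ω φ) :
    ∫ x in Ω, φ x ^ 2 ≤ 4 * R ^ 2 * ∫ x in Ω, ‖gradient φ x‖ ^ 2 := by
  let i : Fin d := ⟨0, hd⟩
  have hsq : Integrable (fun x => φ x ^ 2) (volume.restrict Ω) :=
    ((hφ.memLp 2).restrict Ω).integrable_sq
  have hgrad : Integrable (fun x => ‖gradient φ x‖ ^ 2) (volume.restrict Ω) :=
    ((hφ.memLp_gradient 2).restrict Ω).norm.integrable_sq
  have hpointwise : ∀ x ∈ Ω, -(x i * (2 * φ x * gradient φ x i)) ≤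
      1 / 2 * φ x ^ 2 + 2 * R ^ 2 * ‖gradient φ x‖ ^ 2 := by
    intro x hx
    have hprod : |x i * gradient φ x i| ≤ R * ‖gradient φ x‖ := by
      rw [abs_mul]
      exact mul_le_mul ((PiLp.norm_apply_le x i).trans (hR x hx))
        (PiLp.norm_apply_le (gradient φ x) i) (abs_nonneg _) ((norm_nonneg x).trans (hR x hx))
    nlinarith [sq_nonneg (φ x + 2 * (x i * gradient φ x i)),
      sq_le_sq' (abs_le.1 hprod).1 (abs_le.1 hprod).2]
  have hle : ∫ x in Ω, φ x ^ 2 ≤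
      1 / 2 * (∫ x in Ω, φ x ^ 2) + 2 * R ^ 2 * ∫ x in Ω, ‖gradient φ x‖ ^ 2 := by
    rw [← integral_const_mul, ← integral_const_mul,
      ← integral_add (hsq.const_mul _) (hgrad.const_mul _)]
    conv_lhs => rw [hφ.integral_sq_eq i, ← integral_neg]
    exact setIntegral_mono_on (hφ.integrable_coord_mul i).neg.restrict
      ((hsq.const_mul _).add (hgrad.const_mul _)) hΩ hpointwise
  linarith

end Poincare

section SquareIntegrable

variable {d : ℕ} {Ω : Set (Space d)} {u v w : Space d → ℝ} {Du Dv Dw : Space d → Space d}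

/-- A square integrable function `w` together with a square integrable vector field `Dw`, which
plays the role of its gradient. -/
structure IsL2Pair (Ω : Set (Space d)) (w : Space d → ℝ) (Dw : Space d → Space d) : Prop where
  memLp : MemLp w 2 (volume.restrict Ω)
  memLp_grad : MemLp Dw 2 (volume.restrict Ω)

theorem IsL2Pair.sub (hw : IsL2Pair Ω w Dw) (hv : IsL2Pair Ω v Dv) :
    IsL2Pair Ω (w - v) (Dw - Dv) :=
  ⟨hw.memLp.sub hv.memLp, hw.memLp_grad.sub hv.memLp_grad⟩

theorem IsL2Pair.integrable_norm_sq (hw : IsL2Pair Ω w Dw) :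
    Integrable (fun x => ‖Dw x‖ ^ 2) (volume.restrict Ω) :=
  hw.memLp_grad.norm.integrable_sq

theorem IsH2.isL2Pair {H : Space d → Mat d} (hu : IsH2 Ω u Du H) : IsL2Pair Ω u Du :=
  ⟨hu.memLp, MemLp.of_eval_piLp hu.memLp_grad⟩

theorem Mesh.IsFEFunction.isL2Pair {T : Mesh Ω} (hΩ : IsOpen Ω) (hv : T.IsFEFunction v) :
    IsL2Pair Ω v (gradient v) := by
  have : IsFiniteMeasure (volume.restrict Ω) := ⟨by simpa using T.isBounded.measure_lt_top⟩
  choose! ℓ _ hgrad using fun K (hK : K ∈ T.elements) => hv.exists_hasGradientAt hK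
  obtain ⟨B, hB⟩ := T.isBounded.isCompact_closure.exists_bound_of_continuousOn hv.1
  constructor
  · refine .of_bound ((hv.1.mono subset_closure).aestronglyMeasurable hΩ.measurableSet) B ?_
    filter_upwards [ae_restrict_mem hΩ.measurableSet] with x hx using hB x (subset_closure hx)
  · refine .of_bound (measurable_gradient v).aestronglyMeasurable
      (∑ K ∈ T.elements, ‖affineGradient (ℓ K)‖) ?_
    filter_upwards [T.ae_exists_mem_interior hΩ] with x ⟨K, hK, hx⟩
    rw [(hgrad K hK x hx).gradient]
    exact Finset.single_le_sum (f := fun K => ‖affineGradient (ℓ K)‖)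
      (fun _ _ => norm_nonneg _) hK

theorem Mesh.IsFEFunction.ae_gradient_sub {T : Mesh Ω} (hΩ : IsOpen Ω) (hv : T.IsFEFunction v)
    (hw : T.IsFEFunction w) :
    gradient (v - w) =ᵐ[volume.restrict Ω] gradient v - gradient w := by
  filter_upwards [T.ae_exists_mem_interior hΩ] with x ⟨K, hK, hx⟩
  obtain ⟨ℓ, -, hℓ⟩ := hv.exists_hasGradientAt hK
  obtain ⟨ℓ', -, hℓ'⟩ := hw.exists_hasGradientAt hK
  rw [Pi.sub_apply, (hℓ x hx).gradient, (hℓ' x hx).gradient]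
  refine HasGradientAt.gradient ?_
  simpa only [hasGradientAt_iff_hasFDerivAt, map_sub] using (hℓ x hx).hasFDerivAt.sub
    (hℓ' x hx).hasFDerivAt

end SquareIntegrable

section DominatedConvergence

variable {d : ℕ} {Ω : Set (Space d)} {v : Space d → ℝ} {Dv : Space d → Space d}
  {φ : ℕ → Space d → ℝ} {Dφ : ℕ → Space d → Space d}

theorem IsL2Pair.dominatedTendsto_const (hv : IsL2Pair Ω v Dv) :
    DominatedTendsto Ω (fun _ => v) (fun _ => Dv) v Dv where
  aestronglyMeasurable _ := hv.memLp.1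
  aestronglyMeasurable_grad _ := hv.memLp_grad.1
  exists_majorant := ⟨fun x => |v x| + ‖Dv x‖, hv.memLp.abs.add hv.memLp_grad.norm,
    fun _ => ae_of_all _ fun _ => ⟨le_add_of_nonneg_right (norm_nonneg _),
      le_add_of_nonneg_left (abs_nonneg _)⟩⟩
  tendsto := ae_of_all _ fun _ => tendsto_const_nhds
  tendsto_grad := ae_of_all _ fun _ => tendsto_const_nhds

theorem tendsto_integral_norm_sq {α E : Type*} [MeasurableSpace α] [NormedAddCommGroup E]
    {μ : Measure α} {G : ℕ → α → E} {G₀ : α → E} {m : α → ℝ}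
    (hG : ∀ n, AEStronglyMeasurable (G n) μ) (hm : MemLp m 2 μ)
    (hle : ∀ n, ∀ᵐ x ∂μ, ‖G n x‖ ≤ m x)
    (hlim : ∀ᵐ x ∂μ, Tendsto (fun n => G n x) atTop (𝓝 (G₀ x))) :
    Tendsto (fun n => ∫ x, ‖G n x‖ ^ 2 ∂μ) atTop (𝓝 (∫ x, ‖G₀ x‖ ^ 2 ∂μ)) := by
  refine tendsto_integral_of_dominated_convergence (fun x => m x ^ 2)
    (fun n => (hG n).norm.pow 2) hm.integrable_sq (fun n => ?_) ?_
  · filter_upwards [hle n] with x hx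
    rw [Real.norm_of_nonneg (sq_nonneg _)]
    gcongr
  · filter_upwards [hlim] with x hx using hx.norm.pow 2

namespace DominatedTendsto

theorem tendsto_integral_sq (h : DominatedTendsto Ω φ Dφ v Dv) :
    Tendsto (fun n => ∫ x in Ω, φ n x ^ 2) atTop (𝓝 (∫ x in Ω, v x ^ 2)) := by
  obtain ⟨m, hm, hle⟩ := h.exists_majorant
  simpa only [Real.norm_eq_abs, sq_abs] using tendsto_integral_norm_sq h.aestronglyMeasurable hm
    (fun n => (hle n).mono fun x hx => hx.1) h.tendsto

theorem tendsto_integral_norm_grad_sq (h : DominatedTendsto Ω φ Dφ v Dv) :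
    Tendsto (fun n => ∫ x in Ω, ‖Dφ n x‖ ^ 2) atTop (𝓝 (∫ x in Ω, ‖Dv x‖ ^ 2)) := by
  obtain ⟨m, hm, hle⟩ := h.exists_majorant
  exact tendsto_integral_norm_sq h.aestronglyMeasurable_grad hm
    (fun n => (hle n).mono fun x hx => hx.2) h.tendsto_grad

theorem tendsto_integral_mul (h : DominatedTendsto Ω φ Dφ v Dv) {f : Space d → ℝ}
    (hf : MemLp f 2 (volume.restrict Ω)) :
    Tendsto (fun n => ∫ x in Ω, f x * φ n x) atTop (𝓝 (∫ x in Ω, f x * v x)) := by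
  obtain ⟨m, hm, hle⟩ := h.exists_majorant
  refine tendsto_integral_of_dominated_convergence (fun x => |f x| * m x)
    (fun n => hf.1.mul (h.aestronglyMeasurable n)) (hf.abs.integrable_mul hm) (fun n => ?_) ?_
  · filter_upwards [hle n] with x hx
    rw [norm_mul]
    exact mul_le_mul_of_nonneg_left hx.1 (norm_nonneg _)
  · filter_upwards [h.tendsto] with x hx using hx.const_mul _

end DominatedTendsto

end DominatedConvergence

section BilinearForm

variable {d : ℕ} {Ω : Set (Space d)} {L : Coeffs d} {w w' v : Space d → ℝ}
  {Dw Dw' Dv : Space d → Space d} {Λ : ℝ} {x : Space d}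

/-- The integrand `a ∇w · ∇v + (b · ∇w) v + c w v` of the bilinear form `Coeffs.form`. -/
def Coeffs.integrand (L : Coeffs d) (w : Space d → ℝ) (Dw : Space d → Space d) (v : Space d → ℝ)
    (Dv : Space d → Space d) (x : Space d) : ℝ :=
  inner ℝ (Matrix.toEuclideanLin (L.a x) (Dw x)) (Dv x)
    + inner ℝ (L.b x) (Dw x) * v x + L.c x * w x * v x

/-- The coefficients `a`, `b`, `c` are bounded by `Λ` at the point `x`. -/
structure Coeffs.BoundedAt (L : Coeffs d) (Λ : ℝ) (x : Space d) : Prop where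
  a_le : ∀ ξ ζ : Space d, |inner ℝ (Matrix.toEuclideanLin (L.a x) ξ) ζ| ≤ Λ * (‖ξ‖ * ‖ζ‖)
  b_le : ‖L.b x‖ ≤ Λ
  c_le : |L.c x| ≤ Λ

theorem inner_toEuclideanLin (A : Mat d) (ξ ζ : Space d) :
    inner ℝ (Matrix.toEuclideanLin A ξ) ζ = ∑ i, ∑ j, A i j * ξ j * ζ i := by
  simp [PiLp.inner_apply, Matrix.mulVec, dotProduct, Finset.sum_mul, mul_comm (ζ _)]

theorem abs_inner_toEuclideanLin_le (A : Mat d) (ξ ζ : Space d) :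
    |inner ℝ (Matrix.toEuclideanLin A ξ) ζ| ≤ (∑ i, ∑ j, |A i j|) * (‖ξ‖ * ‖ζ‖) := by
  simp only [inner_toEuclideanLin, Finset.sum_mul]
  refine (Finset.abs_sum_le_sum_abs _ _).trans (Finset.sum_le_sum fun i _ =>
    (Finset.abs_sum_le_sum_abs _ _).trans (Finset.sum_le_sum fun j _ => ?_))
  rw [abs_mul, abs_mul, mul_assoc]
  gcongr
  exacts [PiLp.norm_apply_le ξ j, PiLp.norm_apply_le ζ i]

theorem Coeffs.IsElliptic.exists_boundedAt (hL : L.IsElliptic Ω) :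
    ∃ Λ, ∀ᵐ x ∂(volume.restrict Ω), L.BoundedAt Λ x := by
  let G (x : Space d) : ℝ := ∑ i, ∑ j, |L.a x i j| + ‖L.b x‖ + |L.c x|
  have hG : MemLp G ⊤ (volume.restrict Ω) :=
    ((memLp_finsetSum _ fun i _ => memLp_finsetSum _ fun j _ => (hL.bdd_a i j).abs).add
      (MemLp.of_eval_piLp hL.bdd_b).norm).add hL.bdd_c.abs
  refine ⟨(eLpNorm G ⊤ (volume.restrict Ω)).toReal, ?_⟩
  filter_upwards [ae_le_eLpNormEssSup (f := G) (μ := volume.restrict Ω)] with x hx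
  have hGx : |G x| ≤ (eLpNorm G ⊤ (volume.restrict Ω)).toReal := by
    simpa using ENNReal.toReal_mono hG.eLpNorm_ne_top hx
  have ha : 0 ≤ ∑ i, ∑ j, |L.a x i j| := by positivity
  have hle := (le_abs_self _).trans hGx
  have hb := norm_nonneg (L.b x)
  have hc := abs_nonneg (L.c x)
  simp only [G] at hle
  exact ⟨fun ξ ζ => (abs_inner_toEuclideanLin_le _ ξ ζ).trans (by gcongr; linarith),
    by linarith, by linarith⟩

theorem Coeffs.IsElliptic.aestronglyMeasurable_integrand (hL : L.IsElliptic Ω)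
    (hw : AEStronglyMeasurable w (volume.restrict Ω))
    (hDw : AEStronglyMeasurable Dw (volume.restrict Ω))
    (hv : AEStronglyMeasurable v (volume.restrict Ω))
    (hDv : AEStronglyMeasurable Dv (volume.restrict Ω)) :
    AEStronglyMeasurable (L.integrand w Dw v Dv) (volume.restrict Ω) := by
  have hcoord {G : Space d → Space d} (hG : AEStronglyMeasurable G (volume.restrict Ω))
      (i : Fin d) : AEStronglyMeasurable (fun x => G x i) (volume.restrict Ω) :=
    (EuclideanSpace.proj (𝕜 := ℝ) i).continuous.comp_aestronglyMeasurable hG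
  have ha : AEStronglyMeasurable
      (fun x => inner ℝ (Matrix.toEuclideanLin (L.a x) (Dw x)) (Dv x)) (volume.restrict Ω) := by
    simp only [inner_toEuclideanLin]
    exact Finset.aestronglyMeasurable_fun_sum _ fun i _ =>
      Finset.aestronglyMeasurable_fun_sum _ fun j _ =>
        ((hL.bdd_a i j).1.mul (hcoord hDw j)).mul (hcoord hDv i)
  have hb : AEStronglyMeasurable L.b (volume.restrict Ω) := (MemLp.of_eval_piLp hL.bdd_b).1
  exact (ha.add ((hb.inner hDw).mul hv)).add ((hL.bdd_c.1.mul hw).mul hv)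

theorem Coeffs.BoundedAt.abs_integrand_le (h : L.BoundedAt Λ x) :
    |L.integrand w Dw v Dv x| ≤ Λ * (‖Dw x‖ * ‖Dv x‖ + ‖Dw x‖ * |v x| + |w x| * |v x|) := by
  have hb : |inner ℝ (L.b x) (Dw x) * v x| ≤ Λ * (‖Dw x‖ * |v x|) := by
    rw [abs_mul, ← mul_assoc]
    gcongr
    exact (abs_real_inner_le_norm _ _).trans (by gcongr; exact h.b_le)
  have hc : |L.c x * w x * v x| ≤ Λ * (|w x| * |v x|) := by
    rw [abs_mul, abs_mul, mul_assoc]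
    gcongr
    exact h.c_le
  rw [Coeffs.integrand, mul_add, mul_add]
  exact (abs_add_three _ _ _).trans (add_le_add (add_le_add (h.a_le _ _) hb) hc)

theorem Coeffs.BoundedAt.integrand_le_sq (h : L.BoundedAt Λ x) {δ : ℝ} (hδ : 0 < δ) :
    L.integrand w Dw v Dv x ≤
      2 * δ * (‖Dv x‖ ^ 2 + v x ^ 2) + Λ ^ 2 / (2 * δ) * (‖Dw x‖ ^ 2 + w x ^ 2) := by
  have young (s t : ℝ) : Λ * (s * t) ≤ δ * t ^ 2 + Λ ^ 2 / (4 * δ) * s ^ 2 := by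
    have hsq : δ * t ^ 2 + Λ ^ 2 / (4 * δ) * s ^ 2 - Λ * (s * t) =
        δ * (t - Λ / (2 * δ) * s) ^ 2 := by
      field_simp
      ring
    linarith [mul_nonneg hδ.le (sq_nonneg (t - Λ / (2 * δ) * s))]
  calc L.integrand w Dw v Dv x
      ≤ Λ * (‖Dw x‖ * ‖Dv x‖ + ‖Dw x‖ * |v x| + |w x| * |v x|) :=
        (le_abs_self _).trans h.abs_integrand_le
    _ = Λ * (‖Dw x‖ * ‖Dv x‖) + Λ * (‖Dw x‖ * |v x|) + Λ * (|w x| * |v x|) := by ring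
    _ ≤ _ := add_le_add (add_le_add (young _ _) (young _ _)) (young _ _)
    _ = 2 * δ * (‖Dv x‖ ^ 2 + v x ^ 2) + Λ ^ 2 / (2 * δ) * (‖Dw x‖ ^ 2 + w x ^ 2)
        - δ * ‖Dv x‖ ^ 2 - Λ ^ 2 / (4 * δ) * w x ^ 2 := by
      rw [sq_abs, sq_abs]
      field_simp
      ring
    _ ≤ _ := by
      rw [sub_sub]
      exact sub_le_self _ (by positivity)

theorem Coeffs.IsElliptic.tendsto_form (hL : L.IsElliptic Ω) {ψ φ : ℕ → Space d → ℝ}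
    {Dψ Dφ : ℕ → Space d → Space d} (hψ : DominatedTendsto Ω ψ Dψ w Dw)
    (hφ : DominatedTendsto Ω φ Dφ v Dv) :
    Tendsto (fun n => L.form Ω (ψ n) (Dψ n) (φ n) (Dφ n)) atTop (𝓝 (L.form Ω w Dw v Dv)) := by
  obtain ⟨Λ, hΛ⟩ := hL.exists_boundedAt
  obtain ⟨m, hm, hψm⟩ := hψ.exists_majorant
  obtain ⟨m', hm', hφm⟩ := hφ.exists_majorant
  refine tendsto_integral_of_dominated_convergence (fun x => Λ * (3 * (m x * m' x)))
    (fun n => hL.aestronglyMeasurable_integrand (hψ.1 n) (hψ.2 n) (hφ.1 n) (hφ.2 n))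
    (((hm.integrable_mul hm').const_mul 3).const_mul Λ) (fun n => ?_) ?_
  · filter_upwards [hψm n, hφm n, hΛ] with x hψx hφx hx
    have hΛ0 : 0 ≤ Λ := (abs_nonneg _).trans hx.c_le
    have hm0 : 0 ≤ m x := (abs_nonneg _).trans hψx.1
    refine hx.abs_integrand_le.trans (mul_le_mul_of_nonneg_left ?_ hΛ0)
    have hDD := mul_le_mul hψx.2 hφx.2 (norm_nonneg _) hm0
    have hD := mul_le_mul hψx.2 hφx.1 (abs_nonneg _) hm0
    linarith [mul_le_mul hψx.1 hφx.1 (abs_nonneg _) hm0]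
  · filter_upwards [hψ.tendsto, hψ.tendsto_grad, hφ.tendsto, hφ.tendsto_grad]
      with x hψx hDψx hφx hDφx
    have hcont := LinearMap.continuous_of_finiteDimensional (Matrix.toEuclideanLin (L.a x))
    exact ((((hcont.tendsto _).comp hDψx).inner hDφx).add
      ((tendsto_const_nhds.inner hDψx).mul hφx)).add ((hψx.const_mul _).mul hφx)

theorem Coeffs.IsElliptic.integrable_integrand (hL : L.IsElliptic Ω) (hw : IsL2Pair Ω w Dw)
    (hv : IsL2Pair Ω v Dv) : Integrable (L.integrand w Dw v Dv) (volume.restrict Ω) := by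
  obtain ⟨Λ, hΛ⟩ := hL.exists_boundedAt
  refine ((((hw.memLp_grad.norm.integrable_mul hv.memLp_grad.norm).add
    (hw.memLp_grad.norm.integrable_mul hv.memLp.abs)).add
    (hw.memLp.abs.integrable_mul hv.memLp.abs)).const_mul Λ).mono'
    (hL.aestronglyMeasurable_integrand hw.1.1 hw.2.1 hv.1.1 hv.2.1) ?_
  filter_upwards [hΛ] with x hx using hx.abs_integrand_le

theorem Coeffs.IsElliptic.form_sub_left (hL : L.IsElliptic Ω) (hw : IsL2Pair Ω w Dw)
    (hw' : IsL2Pair Ω w' Dw') (hv : IsL2Pair Ω v Dv) :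
    L.form Ω (w - w') (Dw - Dw') v Dv = L.form Ω w Dw v Dv - L.form Ω w' Dw' v Dv := by
  refine Eq.trans (integral_congr_ae (ae_of_all _ fun x => ?_))
    (integral_sub (hL.integrable_integrand hw hv) (hL.integrable_integrand hw' hv))
  simp only [Pi.sub_apply, map_sub, inner_sub_left, inner_sub_right]
  ring

theorem Coeffs.IsElliptic.form_le (hL : L.IsElliptic Ω)
    (hΛ : ∀ᵐ x ∂(volume.restrict Ω), L.BoundedAt Λ x) (hw : IsL2Pair Ω w Dw)
    (hv : IsL2Pair Ω v Dv) {δ : ℝ} (hδ : 0 < δ) :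
    L.form Ω w Dw v Dv ≤ 2 * δ * ((∫ x in Ω, ‖Dv x‖ ^ 2) + ∫ x in Ω, v x ^ 2) +
      Λ ^ 2 / (2 * δ) * ((∫ x in Ω, ‖Dw x‖ ^ 2) + ∫ x in Ω, w x ^ 2) := by
  have hint {z : Space d → ℝ} {Dz : Space d → Space d} (hz : IsL2Pair Ω z Dz) :
      Integrable (fun x => ‖Dz x‖ ^ 2 + z x ^ 2) (volume.restrict Ω) :=
    hz.integrable_norm_sq.add hz.memLp.integrable_sq
  rw [← integral_add hv.integrable_norm_sq hv.memLp.integrable_sq,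
    ← integral_add hw.integrable_norm_sq hw.memLp.integrable_sq, ← integral_const_mul,
    ← integral_const_mul, ← integral_add ((hint hv).const_mul _) ((hint hw).const_mul _)]
  refine integral_mono_ae (hL.integrable_integrand hw hv)
    (((hint hv).const_mul _).add ((hint hw).const_mul _)) ?_
  filter_upwards [hΛ] with x hx using hx.integrand_le_sq hδ

end BilinearForm

section QuasiOptimality

variable {d : ℕ} {Ω : Set (Space d)} {L : Coeffs d} {f g u v uh : Space d → ℝ}
  {Du Dv : Space d → Space d} {T : Mesh Ω} {β : ℝ}

/-- Functions `v ∈ H¹₀(Ω)`, with gradient `Dv`, in the form of (iterated) dominated limits of test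
functions. Identities and inequalities between integrals of test functions that pass to such limits
are inherited by all of `IsH10`. -/
inductive IsH10 (Ω : Set (Space d)) : (Space d → ℝ) → (Space d → Space d) → Prop
  | of_isTestFunction {φ : Space d → ℝ} (hφ : IsTestFunction Ω φ) : IsH10 Ω φ (gradient φ)
  | of_tendsto {φ : ℕ → Space d → ℝ} {Dφ : ℕ → Space d → Space d} {v : Space d → ℝ}
    {Dv : Space d → Space d} (hφ : ∀ n, IsH10 Ω (φ n) (Dφ n))
    (h : DominatedTendsto Ω φ Dφ v Dv) : IsH10 Ω v Dv

theorem IsH10.integral_sq_le (hd : 1 ≤ d) (hΩ : MeasurableSet Ω) {R : ℝ}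
    (hR : ∀ x ∈ Ω, ‖x‖ ≤ R) (hv : IsH10 Ω v Dv) :
    ∫ x in Ω, v x ^ 2 ≤ 4 * R ^ 2 * ∫ x in Ω, ‖Dv x‖ ^ 2 := by
  induction hv with
  | of_isTestFunction hφ => exact hφ.integral_sq_le hd hR hΩ
  | of_tendsto _ h ih =>
    exact le_of_tendsto_of_tendsto' h.tendsto_integral_sq
      (h.tendsto_integral_norm_grad_sq.const_mul _) ih

theorem IsH10.le_form (hL : L.IsElliptic Ω)
    (hβ : ∀ φ, IsTestFunction Ω φ →
      β * ∫ x in Ω, ‖gradient φ x‖ ^ 2 ≤ L.form Ω φ (gradient φ) φ (gradient φ))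
    (hv : IsH10 Ω v Dv) : β * ∫ x in Ω, ‖Dv x‖ ^ 2 ≤ L.form Ω v Dv v Dv := by
  induction hv with
  | of_isTestFunction hφ => exact hβ _ hφ
  | of_tendsto _ h ih =>
    exact le_of_tendsto_of_tendsto' (h.tendsto_integral_norm_grad_sq.const_mul _)
      (hL.tendsto_form h h) ih

theorem IsH10.form_eq (hL : L.IsElliptic Ω) (hf : MemLp f 2 (volume.restrict Ω))
    (hu : IsL2Pair Ω u Du)
    (heq : ∀ φ, IsTestFunction Ω φ → L.form Ω u Du φ (gradient φ) = ∫ x in Ω, f x * φ x)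
    (hv : IsH10 Ω v Dv) : L.form Ω u Du v Dv = ∫ x in Ω, f x * v x := by
  induction hv with
  | of_isTestFunction hφ => exact heq _ hφ
  | of_tendsto _ h ih =>
    exact tendsto_nhds_unique (hL.tendsto_form hu.dominatedTendsto_const h)
      ((h.tendsto_integral_mul hf).congr fun n => (ih n).symm)

/-- Extended by zero, a finite element function that vanishes on `∂Ω` is Lipschitz on the whole
space. Soft thresholding moves its support into `Ω`, and mollification then makes it smooth. -/
theorem Mesh.IsFEFunction.isH10 (hΩ : IsOpen Ω) (hv : T.IsFEFunction v)
    (h0 : ∀ x ∈ frontier Ω, v x = 0) : IsH10 Ω v (gradient v) := by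
  obtain ⟨M, hlip⟩ := hv.exists_lipschitzWith_indicator hΩ h0
  have hloc := ae_indicator_eventuallyEq hΩ v
  have hzero : ∀ᵐ x ∂(volume.restrict Ω),
      Ω.indicator v x = 0 → gradient (Ω.indicator v) x = 0 := by
    filter_upwards [hloc, hv.ae_gradient_eq_zero hΩ] with x hx hgrad h
    rw [hx.gradient_eq]
    exact hgrad (hx.eq_of_nhds ▸ h)
  obtain ⟨V, hV, hlim⟩ := exists_compactSupport_tendsto T.isBounded hlip
    (fun x hx => Set.indicator_of_notMem hx v) hzero
  refine .of_tendsto (φ := V) (fun n => ?_)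
    { hlim with
      tendsto := ?_
      tendsto_grad := ?_ }
  · obtain ⟨hVlip, hVc, hVs⟩ := hV n
    obtain ⟨φ, hφ, hφlim⟩ := exists_testFunctions_tendsto hΩ T.isBounded hVlip hVc hVs
    exact .of_tendsto (fun k => .of_isTestFunction (hφ k)) hφlim
  · filter_upwards [hlim.tendsto, hloc] with x hx heq using heq.eq_of_nhds ▸ hx
  · filter_upwards [hlim.tendsto_grad, hloc] with x hx heq using heq.gradient_eq ▸ hx

theorem le_of_coercive_bound {I J Q : ℝ} (hβ : 0 < β) (hP : 0 ≤ P) (hJ : J ≤ P * I)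
    (h : ∀ δ > 0, β * I ≤ 2 * δ * (I + J) + Λ ^ 2 / (2 * δ) * Q) :
    I ≤ 4 * Λ ^ 2 * (1 + P) / β ^ 2 * Q := by
  have hδ := h (β / (4 * (1 + P))) (by positivity)
  have habsorb : 2 * (β / (4 * (1 + P))) * (I + J) ≤ β / 2 * I := by
    calc 2 * (β / (4 * (1 + P))) * (I + J) ≤ 2 * (β / (4 * (1 + P))) * ((1 + P) * I) := by
          gcongr
          linarith
      _ = β / 2 * I := by
          field_simp
          norm_num
  have hle : β / 2 * I ≤ β / 2 * (4 * Λ ^ 2 * (1 + P) / β ^ 2 * Q) := by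
    calc β / 2 * I ≤ Λ ^ 2 / (2 * (β / (4 * (1 + P)))) * Q := by linarith
      _ = β / 2 * (4 * Λ ^ 2 * (1 + P) / β ^ 2 * Q) := by
          field_simp
  exact le_of_mul_le_mul_left hle (by positivity)

theorem Coeffs.IsElliptic.exists_integral_grad_sq_le (hd : 1 ≤ d) (hΩ : MeasurableSet Ω)
    (hbdd : Bornology.IsBounded Ω) (hL : L.IsElliptic Ω) :
    ∃ C : ℝ, 0 ≤ C ∧ ∀ {v w : Space d → ℝ} {Dv Dw : Space d → Space d}, IsH10 Ω v Dv →
      IsL2Pair Ω v Dv → IsL2Pair Ω w Dw → L.form Ω v Dv v Dv = L.form Ω w Dw v Dv →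
      ∫ x in Ω, ‖Dv x‖ ^ 2 ≤ C * ((∫ x in Ω, ‖Dw x‖ ^ 2) + ∫ x in Ω, w x ^ 2) := by
  obtain ⟨Λ, hΛ⟩ := hL.exists_boundedAt
  obtain ⟨β, hβ, hcoercive⟩ := hL.coercive
  obtain ⟨R, hR⟩ := hbdd.exists_norm_le
  refine ⟨4 * Λ ^ 2 * (1 + 4 * R ^ 2) / β ^ 2, by positivity, fun hv hv2 hw2 heq => ?_⟩
  refine le_of_coercive_bound hβ (by positivity) (hv.integral_sq_le hd hΩ hR) fun δ hδ => ?_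
  exact (hv.le_form hL hcoercive).trans (heq.trans_le (hL.form_le hΛ hw2 hv2 hδ))

theorem integral_norm_sub_sq_le {α E : Type*} [MeasurableSpace α] [NormedAddCommGroup E]
    {μ : Measure α} {F G : α → E} (hF : MemLp F 2 μ) (hG : MemLp G 2 μ) :
    ∫ x, ‖F x - G x‖ ^ 2 ∂μ ≤ 2 * (∫ x, ‖F x‖ ^ 2 ∂μ) + 2 * ∫ x, ‖G x‖ ^ 2 ∂μ := by
  have hF2 := hF.norm.integrable_sq.const_mul 2
  have hG2 := hG.norm.integrable_sq.const_mul 2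
  rw [← integral_const_mul, ← integral_const_mul, ← integral_add hF2 hG2]
  refine integral_mono (hF.sub hG).norm.integrable_sq (hF2.add hG2) fun x => ?_
  have htri := pow_le_pow_left₀ (norm_nonneg _) (norm_sub_le (F x) (G x)) 2
  dsimp only [Pi.sub_apply]
  linarith [add_sq_le (a := ‖F x‖) (b := ‖G x‖)]

theorem Coeffs.IsElliptic.form_sub_eq (hΩ : IsOpen Ω) (hL : L.IsElliptic Ω)
    (hf : MemLp f 2 (volume.restrict Ω)) (hu : IsL2Pair Ω u Du) (hsol : IsSolution L Ω f g u Du)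
    (huh : IsFESolution L T f g uh) (hv : T.IsFEFunction v)
    (h0 : ∀ x ∈ frontier Ω, (uh - v) x = 0) :
    L.form Ω (uh - v) (gradient (uh - v)) (uh - v) (gradient (uh - v)) =
      L.form Ω (u - v) (Du - gradient v) (uh - v) (gradient (uh - v)) := by
  have hw := huh.mem.sub hv
  have hv2 := hv.isL2Pair hΩ
  have hw2 := hw.isL2Pair hΩ
  calc L.form Ω (uh - v) (gradient (uh - v)) (uh - v) (gradient (uh - v))
      = L.form Ω (uh - v) (gradient uh - gradient v) (uh - v) (gradient (uh - v)) := by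
        refine integral_congr_ae ?_
        filter_upwards [huh.mem.ae_gradient_sub hΩ hv] with x hx
        simp only [hx]
    _ = L.form Ω u Du (uh - v) (gradient (uh - v)) -
          L.form Ω v (gradient v) (uh - v) (gradient (uh - v)) := by
        rw [hL.form_sub_left (huh.mem.isL2Pair hΩ) hv2 hw2, huh.galerkin _ hw h0,
          (hw.isH10 hΩ h0).form_eq hL hf hu hsol.eq]
    _ = _ := (hL.form_sub_left hu hv2 hw2).symm

theorem exists_cea_constant (hd : 1 ≤ d) (hΩ : IsOpen Ω) (hbdd : Bornology.IsBounded Ω)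
    (hL : L.IsElliptic Ω) :
    ∃ C : ℝ, 0 < C ∧ ∀ {f g u : Space d → ℝ} {Du : Space d → Space d},
      MemLp f 2 (volume.restrict Ω) → IsL2Pair Ω u Du → IsSolution L Ω f g u Du →
      ∀ {T : Mesh Ω} {uh v : Space d → ℝ}, IsFESolution L T f g uh → T.IsFEFunction v →
      (∀ p ∈ T.vertices, v p = u p) →
      ∫ x in Ω, ‖Du x - gradient uh x‖ ^ 2 ≤
        C * ((∫ x in Ω, ‖Du x - gradient v x‖ ^ 2) + ∫ x in Ω, (u x - v x) ^ 2) := by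
  obtain ⟨C, hC, hCle⟩ := hL.exists_integral_grad_sq_le hd hΩ.measurableSet hbdd
  refine ⟨2 + 2 * C, by positivity, fun {f g u Du} hf hu hsol {T uh v} huh hv hvu => ?_⟩
  have hw := huh.mem.sub hv
  have h0 : ∀ x ∈ frontier Ω, (uh - v) x = 0 := hw.eq_zero_on_frontier fun p hp hpf => by
    rw [Pi.sub_apply, huh.boundary p hp hpf, hvu p hp, hsol.boundary p hpf, sub_self]
  have he := hu.sub (hv.isL2Pair hΩ)
  have hdiscrete := hCle (hw.isH10 hΩ h0) (hw.isL2Pair hΩ) he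
    (hL.form_sub_eq hΩ hf hu hsol huh hv h0)
  have hsplit : ∫ x in Ω, ‖Du x - gradient uh x‖ ^ 2 ≤
      2 * (∫ x in Ω, ‖Du x - gradient v x‖ ^ 2) + 2 * ∫ x in Ω, ‖gradient (uh - v) x‖ ^ 2 := by
    refine (integral_congr_ae ?_).trans_le
      (integral_norm_sub_sq_le he.memLp_grad (hw.isL2Pair hΩ).memLp_grad)
    filter_upwards [huh.mem.ae_gradient_sub hΩ hv] with x hx
    rw [hx, Pi.sub_apply, sub_sub_sub_cancel_right]
  have hnonneg : 0 ≤ ∫ x in Ω, (u x - v x) ^ 2 := integral_nonneg fun x => sq_nonneg _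
  simp only [Pi.sub_apply] at hdiscrete
  linarith

end QuasiOptimality

section MetricTensor

open Matrix
open scoped MatrixOrder

variable {d : ℕ} {V K : Finset (Space d)} {F : Space d →ᵃ[ℝ] Space d} {A B : Mat d} {c : ℝ}

/-- The quantity `‖det(A)^{1/d} A‖₂`; for `A = α I + |H|` it is the function whose
`L^{d/(d+2)}` quasi-norm enters the error bound. -/
def detNorm (A : Mat d) : ℝ := norm2 (A.det ^ (1 / (d : ℝ)) • A)

theorem detNorm_nonneg (A : Mat d) : 0 ≤ detNorm A := norm2_nonneg _

theorem detNorm_eq (hA : A.PosSemidef) : detNorm A = A.det ^ (1 / (d : ℝ)) * norm2 A := by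
  rw [detNorm, norm2_smul, abs_of_nonneg (Real.rpow_nonneg hA.det_nonneg _)]

theorem rpow_one_div_det_smul (hd : 1 ≤ d) (hA : A.PosSemidef) (hc : 0 ≤ c) :
    (c • A).det ^ (1 / (d : ℝ)) = c * A.det ^ (1 / (d : ℝ)) := by
  rw [det_smul, Fintype.card_fin, Real.mul_rpow (by positivity) hA.det_nonneg, one_div,
    Real.pow_rpow_inv_natCast hc (by lia)]

theorem detNorm_smul (hd : 1 ≤ d) (hA : A.PosSemidef) (hc : 0 ≤ c) :
    detNorm (c • A) = c ^ 2 * detNorm A := by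
  rw [detNorm_eq (hA.smul hc), detNorm_eq hA, rpow_one_div_det_smul hd hA hc, norm2_smul,
    abs_of_nonneg hc]
  ring

theorem detNorm_mono (hA : A.PosDef) (h : A ≤ B) : detNorm A ≤ detNorm B := by
  have hB : B.PosSemidef := by simpa using hA.posSemidef.add (le_iff.1 h)
  rw [detNorm_eq hA.posSemidef, detNorm_eq hB]
  exact mul_le_mul (Real.rpow_le_rpow hA.det_pos.le (det_le_det_of_le hA h) (by positivity))
    (norm2_mono hA.posSemidef h) (norm2_nonneg A) (Real.rpow_nonneg hB.det_nonneg _)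

/-- The metric tensor `det(A)^{-1/(d+2)} ‖A‖₂^{2/(d+2)} A` generated by a positive definite
matrix `A`. -/
def metricTensor (A : Mat d) : Mat d :=
  (A.det ^ (-(1 / ((d : ℝ) + 2))) * norm2 A ^ (2 / ((d : ℝ) + 2))) • A

theorem metricTensor_scale_pos (hd : 1 ≤ d) (hA : A.PosDef) :
    0 < A.det ^ (-(1 / ((d : ℝ) + 2))) * norm2 A ^ (2 / ((d : ℝ) + 2)) :=
  mul_pos (Real.rpow_pos_of_pos hA.det_pos _) (Real.rpow_pos_of_pos (norm2_pos hd hA) _)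

theorem det_metricTensor_rpow_half (hd : 1 ≤ d) (hA : A.PosDef) :
    (metricTensor A).det ^ (1 / 2 : ℝ) = detNorm A ^ ((d : ℝ) / ((d : ℝ) + 2)) := by
  have hdet := hA.det_pos
  have hnorm := norm2_pos hd hA
  have hd0 : (d : ℝ) ≠ 0 := by positivity
  rw [detNorm_eq hA.posSemidef, metricTensor, det_smul, Fintype.card_fin]
  obtain ⟨x, hx⟩ : ∃ x, Real.exp x = A.det := ⟨_, Real.exp_log hdet⟩
  obtain ⟨y, hy⟩ : ∃ y, Real.exp y = norm2 A := ⟨_, Real.exp_log hnorm⟩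
  simp only [← hx, ← hy, ← Real.exp_mul, ← Real.exp_add, ← Real.exp_nat_mul]
  congr 1
  field_simp
  ring

/-- The volume of the element `K` in the metric `M`. -/
def metricVol (K : Finset (Space d)) (M : Mat d) : ℝ := vol K * M.det ^ (1 / 2 : ℝ)

theorem metricVol_metricTensor (hd : 1 ≤ d) (hA : A.PosDef) :
    metricVol K (metricTensor A) = vol K * detNorm A ^ ((d : ℝ) / ((d : ℝ) + 2)) := by
  rw [metricVol, det_metricTensor_rpow_half hd hA]

theorem metricVol_metricTensor_nonneg (hd : 1 ≤ d) (hA : A.PosDef) :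
    0 ≤ metricVol K (metricTensor A) := by
  rw [metricVol_metricTensor hd hA]
  exact mul_nonneg (vol_nonneg K) (Real.rpow_nonneg (detNorm_nonneg A) _)

theorem metricVol_metricTensor_rpow (hd : 1 ≤ d) (hA : A.PosDef) (hK : 0 < vol K)
    (hV : vol V = 1) (hF : F '' simplex V = simplex K) :
    metricVol K (metricTensor A) ^ (((d : ℝ) + 2) / d) =
      vol K * (norm2 A * (pullback F A).det ^ (1 / (d : ℝ))) := by
  have hd0 : (0 : ℝ) < d := by positivity
  have hvol : vol K ^ (((d : ℝ) + 2) / d) = vol K * (vol K ^ 2) ^ (1 / (d : ℝ)) := by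
    rw [add_div, div_self hd0.ne', Real.rpow_add hK, Real.rpow_one, ← Real.rpow_natCast_mul hK.le]
    simp only [Nat.cast_ofNat, mul_one_div]
  have hexp : (d : ℝ) / ((d : ℝ) + 2) * (((d : ℝ) + 2) / d) = 1 := by field_simp
  rw [metricVol_metricTensor hd hA, Real.mul_rpow hK.le (Real.rpow_nonneg (detNorm_nonneg A) _),
    ← Real.rpow_mul (detNorm_nonneg A), hexp, Real.rpow_one, hvol, detNorm_eq hA.posSemidef,
    det_pullback hV hF, Real.mul_rpow (sq_nonneg _) hA.det_pos.le]
  ring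

/-- The alignment condition is homogeneous in the metric tensor, so that it does not see the
scalar factor of `metricTensor`. -/
theorem trace_pullback_le_of_alignment (hd : 1 ≤ d) (hA : A.PosDef) (hV : vol V = 1)
    (hF : F '' simplex V = simplex K) {Cali : ℝ}
    (h : (1 / (d : ℝ)) * (pullback F (metricTensor A)).trace ≤
      Cali * vol K ^ (2 / (d : ℝ)) * (metricTensor A).det ^ (1 / (d : ℝ))) :
    (pullback F A).trace ≤ d * Cali * (pullback F A).det ^ (1 / (d : ℝ)) := by
  have hd0 : (0 : ℝ) < d := by positivity
  have hvol : vol K ^ (2 / (d : ℝ)) = (vol K ^ 2) ^ (1 / (d : ℝ)) := by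
    rw [← Real.rpow_natCast_mul (vol_nonneg K), Nat.cast_ofNat, mul_one_div]
  have hρ := metricTensor_scale_pos hd hA
  rw [metricTensor, pullback_smul, trace_smul, rpow_one_div_det_smul hd hA.posSemidef hρ.le,
    smul_eq_mul, hvol, one_div_mul_eq_div, div_le_iff₀ hd0] at h
  rw [det_pullback hV hF, Real.mul_rpow (sq_nonneg _) hA.det_pos.le]
  refine le_of_mul_le_mul_left (h.trans (le_of_eq ?_)) hρ
  ring

end MetricTensor

section ElementError

open Matrix
open scoped MatrixOrder

variable {d : ℕ} {Ω : Set (Space d)} {T : Mesh Ω} {u v : Space d → ℝ} {Du : Space d → Space d}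
  {H : Space d → Mat d} {V K : Finset (Space d)} {F : Space d →ᵃ[ℝ] Space d} {A : Mat d}
  {c₀ : Space d} {r c κ : ℝ}

theorem le_of_det_mul_le_trace_pow (hd : 1 ≤ d) {P : Mat d} (hP : P.PosDef)
    (htr : P.trace ≤ κ * P.det ^ (1 / (d : ℝ))) {e s n : ℝ} (hs : 0 ≤ s) (hn : 0 ≤ n)
    (h : P.det * e ≤ s * (n * P.trace ^ (d + 1))) :
    e ≤ s * (κ ^ (d + 1) * (n * P.det ^ (1 / (d : ℝ)))) := by
  set τ := P.det ^ (1 / (d : ℝ)) with hτ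
  have hdet : P.det = τ ^ d := by
    rw [hτ, one_div, Real.rpow_inv_natCast_pow hP.det_pos.le (by lia)]
  have htr0 : 0 ≤ P.trace := hP.posSemidef.trace_nonneg
  refine le_of_mul_le_mul_left (h.trans ?_) hP.det_pos
  calc s * (n * P.trace ^ (d + 1)) ≤ s * (n * (κ * τ) ^ (d + 1)) := by gcongr
    _ = P.det * (s * (κ ^ (d + 1) * (n * τ))) := by rw [hdet]; ring

theorem ae_abs_quad_le_of_matAbs_le (hΩ : IsOpen Ω) (hu : IsH2 Ω u Du H) {U : Set (Space d)}
    (hU : U ⊆ Ω) (h : ∀ᵐ x ∂(volume.restrict U), matAbs (H x) ≤ c • A) :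
    ∀ᵐ x ∂(volume.restrict U), ∀ ξ, |quad (H x) ξ| ≤ c * quad A ξ := by
  filter_upwards [h, ae_restrict_of_ae_restrict_of_subset hU (hu.ae_isHermitian hΩ)]
    with x hx hH ξ
  exact (abs_quad_le_quad_matAbs hH ξ).trans ((quad_mono hx ξ).trans_eq (quad_smul c A ξ))

theorem ae_abs_sub_tangent_le (hΩ : IsOpen Ω) (hu : IsH2 Ω u Du H)
    (hcont : ContinuousOn u (closure Ω)) (hK : K ∈ T.elements)
    (h : ∀ᵐ x ∂(volume.restrict (simplex K)), matAbs (H x) ≤ c • A) :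
    ∀ᵐ x ∂(volume.restrict (interior (simplex K))), ∀ y ∈ simplex K,
      |u y - u x - inner ℝ (Du x) (y - x)| ≤ c * quad A (y - x) / 2 := by
  have hsub := Mesh.interior_simplex_subset hΩ hK
  have hquad := ae_abs_quad_le_of_matAbs_le hΩ hu hsub
    (ae_restrict_of_ae_restrict_of_subset interior_subset h)
  have htaylor := (hu.mono hΩ.measurableSet hsub).ae_abs_taylor_le isOpen_interior
    (convex_simplex K).interior (hcont.mono (closure_mono hsub))
    (continuous_const.mul (continuous_quad A)) hquad
  rwa [closure_interior_simplex (Mesh.affineIndependent hK) (Mesh.card_eq hK)] at htaylor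

theorem restrict_interior_simplex (K : Finset (Space d)) :
    volume.restrict (interior (simplex K)) = volume.restrict (simplex K) :=
  Measure.restrict_congr_set (interior_ae_eq_of_null_frontier (volume_frontier_simplex K))

/-- The constant of the elementwise interpolation estimate, for a reference element with vertex set
`V` that contains a ball of radius `r`, and elements of diameter at most `δ`. -/
def interpConst (V : Finset (Space d)) (r δ : ℝ) : ℝ :=
  (1 + δ ^ 2) * (Metric.diam (simplex V) ^ 2 / r) ^ 2 * d ^ (d + 1)

theorem ae_interpolation_error_le (hd : 1 ≤ d) (hΩ : IsOpen Ω) (hu : IsH2 Ω u Du H)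
    (hcont : ContinuousOn u (closure Ω)) (hv : T.IsFEFunction v)
    (hvu : ∀ p ∈ T.vertices, v p = u p) (hV : vol V = 1) (hK : K ∈ T.elements)
    (hF : F '' simplex V = simplex K) (hr : 0 < r)
    (hball : Metric.closedBall c₀ r ⊆ simplex V) {δ : ℝ} (hδ : Metric.diam (simplex K) ≤ δ)
    (hA : A.PosDef) (hc : 0 ≤ c) {Cali : ℝ}
    (htr : (pullback F A).trace ≤ d * Cali * (pullback F A).det ^ (1 / (d : ℝ)))
    (h : ∀ᵐ x ∂(volume.restrict (simplex K)), matAbs (H x) ≤ c • A) :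
    ∀ᵐ x ∂(volume.restrict (simplex K)),
      ‖Du x - gradient v x‖ ^ 2 + (u x - v x) ^ 2 ≤ interpConst V r δ * Cali ^ (d + 1) * c ^ 2 *
        (norm2 A * (pullback F A).det ^ (1 / (d : ℝ))) := by
  have hJ : (jacobian F).det ≠ 0 := by
    rw [← abs_pos, ← mul_one |_|, ← hV, abs_det_jacobian_mul_vol hF]
    exact Mesh.vol_pos hK
  have hP := pullback_posDef hJ hA
  obtain ⟨ℓ, hvℓ, hgrad⟩ := hv.exists_hasGradientAt hK
  have hℓ : (K : Set (Space d)).EqOn ℓ u := fun p hp =>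
    (hvℓ (mem_simplex hp)).symm.trans (hvu p (Mesh.mem_vertices_of_mem_face (Mesh.mem_faces hK) hp))
  rw [← restrict_interior_simplex]
  filter_upwards [ae_abs_sub_tangent_le hΩ hu hcont hK h,
    ae_restrict_mem isOpen_interior.measurableSet] with x hT hx
  have hxK := interior_subset hx
  have hvalue := le_of_det_mul_le_trace_pow hd hP htr (by positivity) (norm2_nonneg A) <|
    (det_mul_sq_interpolant_sub_le hd hA hJ hF hr hball hc hxK hT hℓ hδ).trans_eq
      (mul_assoc _ _ _).symm
  have hgradient := le_of_det_mul_le_trace_pow hd hP htr (sq_nonneg _) (norm2_nonneg A)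
    (det_mul_sq_gradient_sub_le hd hA hJ hF hr hball hc hxK hT hℓ)
  rw [hvℓ hxK, (hgrad x hx).gradient]
  refine (add_le_add hgradient hvalue).trans_eq ?_
  rw [interpConst]
  ring

end ElementError

section MeshSum

variable {d : ℕ} {Ω : Set (Space d)}

theorem Mesh.restrict_eq_sum (hΩ : IsOpen Ω) (T : Mesh Ω) :
    volume.restrict Ω = ∑ K ∈ T.elements, volume.restrict (simplex K) := by
  have hae : Ω =ᵐ[volume] ⋃ K : T.elements, interior (simplex K.1) := by
    filter_upwards [(ae_restrict_iff' hΩ.measurableSet).1 (T.ae_exists_mem_interior hΩ)] with x hx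
    refine propext ⟨fun hxΩ => ?_, fun hxU => ?_⟩
    · obtain ⟨K, hK, hxK⟩ := hx hxΩ
      exact Set.mem_iUnion.2 ⟨⟨K, hK⟩, hxK⟩
    · obtain ⟨K, hxK⟩ := Set.mem_iUnion.1 hxU
      exact interior_simplex_subset hΩ K.2 hxK
  rw [Measure.restrict_congr_set hae, Measure.restrict_iUnion
    (fun K K' hne => disjoint_interior K.2 K'.2 fun h => hne (Subtype.ext h))
    fun K => isOpen_interior.measurableSet]
  simp only [restrict_interior_simplex]
  exact Measure.sum_coe_finset T.elements fun K => volume.restrict (simplex K)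

theorem Mesh.ae_restrict_iff (hΩ : IsOpen Ω) (T : Mesh Ω) {p : Space d → Prop} :
    (∀ᵐ x ∂(volume.restrict Ω), p x) ↔
      ∀ K ∈ T.elements, ∀ᵐ x ∂(volume.restrict (simplex K)), p x := by
  rw [T.restrict_eq_sum hΩ]
  simp only [ae_iff, Measure.finsetSum_apply, Finset.sum_eq_zero_iff]

theorem Mesh.setIntegral_le_sum (hΩ : IsOpen Ω) (T : Mesh Ω) {h : Space d → ℝ}
    (hh : IntegrableOn h Ω) {m : Finset (Space d) → ℝ}
    (hm : ∀ K ∈ T.elements, ∀ᵐ x ∂(volume.restrict (simplex K)), h x ≤ m K) :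
    ∫ x in Ω, h x ≤ ∑ K ∈ T.elements, vol K * m K := by
  rw [IntegrableOn, T.restrict_eq_sum hΩ, integrable_finsetSum_measure] at hh
  rw [T.restrict_eq_sum hΩ, integral_finsetSum_measure hh]
  refine Finset.sum_le_sum fun K hK => ?_
  have hconst : ∫ _ in simplex K, m K = vol K * m K := by rw [setIntegral_const, smul_eq_mul, vol]
  rw [← hconst]
  exact setIntegral_mono_ae_restrict (hh K hK)
    (integrableOn_const (isCompact_simplex K).measure_lt_top.ne) (hm K hK)

theorem Mesh.ofReal_sum_le_lintegral (hΩ : IsOpen Ω) (T : Mesh Ω) {h : Space d → ENNReal}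
    {s : Finset (Space d) → ℝ} (hs0 : ∀ K, 0 ≤ s K)
    (hs : ∀ K ∈ T.elements, ∀ᵐ x ∂(volume.restrict (simplex K)), ENNReal.ofReal (s K) ≤ h x) :
    ENNReal.ofReal (∑ K ∈ T.elements, vol K * s K) ≤ ∫⁻ x in Ω, h x := by
  rw [T.restrict_eq_sum hΩ, lintegral_finsetSum_measure,
    ENNReal.ofReal_sum_of_nonneg fun K _ => mul_nonneg (vol_nonneg K) (hs0 K)]
  refine Finset.sum_le_sum fun K hK => ?_
  calc ENNReal.ofReal (vol K * s K) = ∫⁻ _ in simplex K, ENNReal.ofReal (s K) := by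
        rw [setLIntegral_const, mul_comm, ENNReal.ofReal_mul (hs0 K), vol,
          ofReal_measureReal (isCompact_simplex K).measure_lt_top.ne]
    _ ≤ ∫⁻ x in simplex K, h x := lintegral_mono_ae (hs K hK)

theorem Mesh.ofReal_sum_rpow_le_eLpNorm (hΩ : IsOpen Ω) (T : Mesh Ω) {p : ℝ} (hp : 0 < p)
    {h : Space d → ℝ} {s : Finset (Space d) → ℝ} (hs0 : ∀ K, 0 ≤ s K)
    (hs : ∀ K ∈ T.elements, ∀ᵐ x ∂(volume.restrict (simplex K)), s K ≤ h x) :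
    ENNReal.ofReal ((∑ K ∈ T.elements, vol K * s K ^ p) ^ (1 / p)) ≤
      eLpNorm h (ENNReal.ofReal p) (volume.restrict Ω) := by
  have hle := T.ofReal_sum_le_lintegral hΩ (h := fun x => ‖h x‖ₑ ^ p)
    (fun K => Real.rpow_nonneg (hs0 K) p) fun K hK => (hs K hK).mono fun x hx => by
      rw [← ENNReal.ofReal_rpow_of_nonneg (hs0 K) hp.le, Real.enorm_of_nonneg ((hs0 K).trans hx)]
      gcongr
  rw [eLpNorm_eq_lintegral_rpow_enorm_toReal (by simpa using hp) ENNReal.ofReal_ne_top,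
    ENNReal.toReal_ofReal hp.le, ← ENNReal.ofReal_rpow_of_nonneg (Finset.sum_nonneg fun K _ =>
      mul_nonneg (vol_nonneg K) (Real.rpow_nonneg (hs0 K) p)) (by positivity)]
  gcongr

theorem Mesh.eLpNorm_lt_top (hΩ : IsOpen Ω) (T : Mesh Ω) {p : ENNReal} {h : Space d → ℝ}
    {m : Finset (Space d) → ℝ}
    (hm : ∀ K ∈ T.elements, ∀ᵐ x ∂(volume.restrict (simplex K)), ‖h x‖ ≤ m K) :
    eLpNorm h p (volume.restrict Ω) < ⊤ := by
  have hbound : ∀ᵐ x ∂(volume.restrict Ω), ‖h x‖ ≤ ∑ K ∈ T.elements, |m K| :=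
    (T.ae_restrict_iff hΩ).2 fun K hK => (hm K hK).mono fun x hx =>
      (hx.trans (le_abs_self _)).trans (Finset.single_le_sum (fun K _ => abs_nonneg (m K)) hK)
  refine (eLpNorm_le_of_ae_bound hbound).trans_lt (ENNReal.mul_lt_top
    (ENNReal.rpow_lt_top_of_nonneg (by positivity) ?_) ENNReal.ofReal_lt_top)
  rw [Measure.restrict_apply_univ]
  exact T.isBounded.measure_lt_top.ne

end MeshSum

section GlobalError

open Matrix
open scoped MatrixOrder

variable {d : ℕ} {Ω : Set (Space d)}

theorem IsReferenceElement.exists_closedBall_subset {V : Finset (Space d)}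
    (hV : IsReferenceElement V) : ∃ c₀ r, 0 < r ∧ Metric.closedBall c₀ r ⊆ simplex V := by
  obtain ⟨c₀, hc₀⟩ := interior_simplex_nonempty hV.2.1 hV.1
  obtain ⟨r, hr, hball⟩ := Metric.nhds_basis_closedBall.mem_iff.1 (mem_interior_iff_mem_nhds.1 hc₀)
  exact ⟨c₀, r, hr, hball⟩

theorem IsReferenceElement.diam_pos (hd : 1 ≤ d) {V : Finset (Space d)}
    (hV : IsReferenceElement V) : 0 < Metric.diam (simplex V) := by
  have hnontrivial : (V : Set (Space d)).Nontrivial :=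
    Finset.one_lt_card_iff_nontrivial.1 (by rw [hV.1]; lia)
  exact Metric.diam_pos (hnontrivial.mono (subset_convexHull ℝ _)) (isCompact_simplex V).isBounded

theorem exists_interpolation_constant (hd : 1 ≤ d) (hΩ : IsOpen Ω)
    (hbdd : Bornology.IsBounded Ω) {V : Finset (Space d)} (hV : IsReferenceElement V) :
    ∃ C : ℝ, 0 < C ∧ ∀ {u v : Space d → ℝ} {Du : Space d → Space d} {H : Space d → Mat d},
      ContinuousOn u (closure Ω) → IsH2 Ω u Du H →
      ∀ {T : Mesh Ω} {F : Finset (Space d) → Space d →ᵃ[ℝ] Space d},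
      (∀ K ∈ T.elements, F K '' simplex V = simplex K) →
      T.IsFEFunction v → (∀ p ∈ T.vertices, v p = u p) →
      ∀ {A : Finset (Space d) → Mat d} {c : Finset (Space d) → ℝ} {Cali : ℝ},
      (∀ K ∈ T.elements, (A K).PosDef) → (∀ K, 0 ≤ c K) →
      (∀ K ∈ T.elements, ∀ᵐ x ∂(volume.restrict (simplex K)), matAbs (H x) ≤ c K • A K) →
      (∀ K ∈ T.elements, (1 / (d : ℝ)) * (pullback (F K) (metricTensor (A K))).trace ≤
        Cali * vol K ^ (2 / (d : ℝ)) * (metricTensor (A K)).det ^ (1 / (d : ℝ))) →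
      (∫ x in Ω, ‖Du x - gradient v x‖ ^ 2) + ∫ x in Ω, (u x - v x) ^ 2 ≤
        C * Cali ^ (d + 1) * ∑ K ∈ T.elements,
          c K ^ 2 * metricVol K (metricTensor (A K)) ^ (((d : ℝ) + 2) / d) := by
  obtain ⟨c₀, r, hr, hball⟩ := hV.exists_closedBall_subset
  have hdiam := hV.diam_pos hd
  refine ⟨interpConst V r (Metric.diam (closure Ω)), by unfold interpConst; positivity, ?_⟩
  intro u v Du H hcont hu T F hF hv hvu A c Cali hA hc hH halign
  have helement := fun K hK => ae_interpolation_error_le hd hΩ hu hcont hv hvu hV.2.2 hK (hF K hK)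
    hr hball (Metric.diam_mono (Mesh.simplex_subset_closure hK) hbdd.closure) (hA K hK) (hc K)
    (trace_pullback_le_of_alignment hd (hA K hK) hV.2.2 (hF K hK) (halign K hK)) (hH K hK)
  have he := hu.isL2Pair.sub (hv.isL2Pair hΩ)
  have hgrad : IntegrableOn (fun x => ‖Du x - gradient v x‖ ^ 2) Ω := he.integrable_norm_sq
  have hvalue : IntegrableOn (fun x => (u x - v x) ^ 2) Ω := he.memLp.integrable_sq
  rw [← integral_add hgrad hvalue]
  refine (T.setIntegral_le_sum hΩ (hgrad.add hvalue) helement).trans_eq ?_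
  rw [Finset.mul_sum]
  refine Finset.sum_congr rfl fun K hK => ?_
  rw [metricVol_metricTensor_rpow hd (hA K hK) (Mesh.vol_pos hK) hV.2.2 (hF K hK)]
  ring

theorem sum_sq_mul_rpow_le_of_equidistributed {ι : Type*} {s : Finset ι} {w c : ι → ℝ}
    {q Ceq C : ℝ} (hq : 0 ≤ q) (hCeq : 0 ≤ Ceq) (hw : ∀ i ∈ s, 0 ≤ w i)
    (hequi : ∀ i ∈ s, w i ≤ Ceq * ((1 / (s.card : ℝ)) * ∑ j ∈ s, w j))
    (hc : √((1 / (s.card : ℝ)) * ∑ i ∈ s, c i ^ 2) ≤ C) :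
    ∑ i ∈ s, c i ^ 2 * w i ^ q ≤ Ceq ^ q * (s.card : ℝ) ^ (1 - q) * C ^ 2 * (∑ i ∈ s, w i) ^ q := by
  have hσ : 0 ≤ ∑ i ∈ s, w i := Finset.sum_nonneg hw
  rcases s.eq_empty_or_nonempty with rfl | hs
  · rw [Finset.sum_empty]
    positivity
  have hN : (0 : ℝ) < s.card := by exact_mod_cast hs.card_pos
  have hsq : ∑ i ∈ s, c i ^ 2 ≤ s.card * C ^ 2 := by
    rw [← inv_mul_le_iff₀ hN, ← one_div]
    exact (Real.sqrt_le_iff.1 hc).2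
  calc ∑ i ∈ s, c i ^ 2 * w i ^ q
      ≤ ∑ i ∈ s, c i ^ 2 * (Ceq * ((1 / (s.card : ℝ)) * ∑ j ∈ s, w j)) ^ q :=
        Finset.sum_le_sum fun i hi => mul_le_mul_of_nonneg_left
          (Real.rpow_le_rpow (hw i hi) (hequi i hi) hq) (sq_nonneg _)
    _ = (∑ i ∈ s, c i ^ 2) * (Ceq * ((1 / (s.card : ℝ)) * ∑ j ∈ s, w j)) ^ q :=
        (Finset.sum_mul _ _ _).symm
    _ ≤ s.card * C ^ 2 * (Ceq * ((1 / (s.card : ℝ)) * ∑ j ∈ s, w j)) ^ q := by gcongr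
    _ = Ceq ^ q * (s.card : ℝ) ^ (1 - q) * C ^ 2 * (∑ i ∈ s, w i) ^ q := by
        rw [Real.mul_rpow hCeq (by positivity), Real.mul_rpow (by positivity) hσ, one_div,
          Real.inv_rpow hN.le, Real.rpow_sub hN, Real.rpow_one]
        ring

theorem Mesh.sq_mul_rpow_sum_le_hessianFactor (hd : 1 ≤ d) (hΩ : IsOpen Ω) (T : Mesh Ω)
    {H : Space d → Mat d} {A : Finset (Space d) → Mat d} {c : Finset (Space d) → ℝ} {α ρ : ℝ}
    (hρ : 0 < ρ) (hA : ∀ K ∈ T.elements, (A K).PosDef)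
    (hlower : ∀ K ∈ T.elements, ∀ᵐ x ∂(volume.restrict (simplex K)), ρ • A K ≤ regAbs α (H x))
    (hupper : ∀ K ∈ T.elements, ∀ᵐ x ∂(volume.restrict (simplex K)),
      matAbs (H x) ≤ c K • A K) :
    ρ ^ 2 * (∑ K ∈ T.elements, metricVol K (metricTensor (A K))) ^ (((d : ℝ) + 2) / d) ≤
      hessianFactor Ω α H := by
  set p : ℝ := (d : ℝ) / (d + 2) with hp
  have hp0 : 0 < p := by positivity
  have hfinite : eLpNorm (fun x => detNorm (regAbs α (H x))) (ENNReal.ofReal p)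
      (volume.restrict Ω) < ⊤ := by
    refine T.eLpNorm_lt_top hΩ (m := fun K => detNorm (α • 1 + c K • A K)) fun K hK => ?_
    filter_upwards [hlower K hK, hupper K hK] with x hxl hxu
    have hpos : (regAbs α (H x)).PosDef := by
      simpa using ((hA K hK).smul hρ).add_posSemidef (le_iff.1 hxl)
    rw [Real.norm_of_nonneg (detNorm_nonneg _)]
    exact detNorm_mono hpos (add_le_add_right hxu _)
  have hnorm := T.ofReal_sum_rpow_le_eLpNorm hΩ hp0 (h := fun x => detNorm (regAbs α (H x)))
    (s := fun K => ρ ^ 2 * detNorm (A K)) (fun K => mul_nonneg (sq_nonneg ρ) (detNorm_nonneg _))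
    fun K hK => (hlower K hK).mono fun x hx =>
      (detNorm_smul hd (hA K hK).posSemidef hρ.le).symm.trans_le
        (detNorm_mono ((hA K hK).smul hρ) hx)
  have hsum : ∑ K ∈ T.elements, vol K * (ρ ^ 2 * detNorm (A K)) ^ p =
      (ρ ^ 2) ^ p * ∑ K ∈ T.elements, metricVol K (metricTensor (A K)) := by
    rw [Finset.mul_sum]
    refine Finset.sum_congr rfl fun K hK => ?_
    rw [metricVol_metricTensor hd (hA K hK), Real.mul_rpow (sq_nonneg ρ) (detNorm_nonneg _)]
    ring
  have hσ : 0 ≤ ∑ K ∈ T.elements, metricVol K (metricTensor (A K)) :=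
    Finset.sum_nonneg fun K hK => metricVol_metricTensor_nonneg hd (hA K hK)
  rw [hsum, Real.mul_rpow (by positivity) hσ, ← Real.rpow_mul (sq_nonneg ρ),
    mul_one_div_cancel hp0.ne', Real.rpow_one] at hnorm
  rw [← one_div_div, ← hp]
  exact (ENNReal.ofReal_le_iff_le_toReal hfinite.ne).1 hnorm

theorem sqrt_le_error_bound {I C Cali Ceq ρ Cp N S h : ℝ} (hC : 0 ≤ C) (hCali : 0 ≤ Cali)
    (hCeq : 0 ≤ Ceq) (hρ : 0 < ρ) (hCp : 0 ≤ Cp) (hN : 0 ≤ N) (hd : 1 ≤ d)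
    (hI : I ≤ C * (Cali ^ (d + 1) * (Ceq ^ (((d : ℝ) + 2) / d) *
      N ^ (1 - ((d : ℝ) + 2) / d) * Cp ^ 2 * S)))
    (hS : ρ ^ 2 * S ≤ h) (hS0 : 0 ≤ S) :
    √I ≤ √C * (Cali ^ (((d : ℝ) + 1) / 2) * Ceq ^ (((d : ℝ) + 2) / (2 * (d : ℝ)))) *
      (Cp / ρ) * N ^ (-(1 / (d : ℝ))) * h ^ (1 / 2 : ℝ) := by
  have hd0 : (d : ℝ) ≠ 0 := by positivity
  have hh : 0 ≤ h := (by positivity : 0 ≤ ρ ^ 2 * S).trans hS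
  have hali : Cali ^ (d + 1) = (Cali ^ (((d : ℝ) + 1) / 2)) ^ 2 := by
    rw [← Real.rpow_mul_natCast hCali, ← Real.rpow_natCast]
    congr 1
    push_cast
    ring
  have heq : Ceq ^ (((d : ℝ) + 2) / d) = (Ceq ^ (((d : ℝ) + 2) / (2 * (d : ℝ)))) ^ 2 := by
    rw [← Real.rpow_mul_natCast hCeq]
    congr 1
    field_simp
    norm_num
  have hNpow : N ^ (1 - ((d : ℝ) + 2) / d) = (N ^ (-(1 / (d : ℝ)))) ^ 2 := by
    rw [← Real.rpow_mul_natCast hN]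
    congr 1
    field_simp
    norm_num
  rw [← Real.sqrt_eq_rpow h]
  refine Real.sqrt_le_iff.2 ⟨by positivity, hI.trans ?_⟩
  rw [hali, heq, hNpow]
  simp only [mul_pow, div_pow, Real.sq_sqrt hC, Real.sq_sqrt hh]
  have hSle : S ≤ h / ρ ^ 2 := (le_div_iff₀' (by positivity)).2 hS
  calc C * ((Cali ^ (((d : ℝ) + 1) / 2)) ^ 2 * ((Ceq ^ (((d : ℝ) + 2) / (2 * (d : ℝ)))) ^ 2 *
        (N ^ (-(1 / (d : ℝ)))) ^ 2 * Cp ^ 2 * S))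
      ≤ C * ((Cali ^ (((d : ℝ) + 1) / 2)) ^ 2 * ((Ceq ^ (((d : ℝ) + 2) / (2 * (d : ℝ)))) ^ 2 *
        (N ^ (-(1 / (d : ℝ)))) ^ 2 * Cp ^ 2 * (h / ρ ^ 2))) := by gcongr
    _ = C * ((Cali ^ (((d : ℝ) + 1) / 2)) ^ 2 * (Ceq ^ (((d : ℝ) + 2) / (2 * (d : ℝ)))) ^ 2) *
        (Cp ^ 2 / ρ ^ 2) * (N ^ (-(1 / (d : ℝ)))) ^ 2 * h := by ring

end GlobalError

end

end AnisoFEM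

open scoped MatrixOrder in
theorem theorem3p1_general {d : ℕ} (hd : 1 ≤ d) {Ω : Set (Space d)} (hΩ : IsOpen Ω)
    (hbdd : Bornology.IsBounded Ω) {L : Coeffs d} (hL : L.IsElliptic Ω)
    {Khat : Finset (Space d)} (hKhat : IsReferenceElement Khat) :
    ∃ C : ℝ, 0 < C ∧
      ∀ f g : Space d → ℝ, MemLp f 2 (volume.restrict Ω) →
      ∀ (u : Space d → ℝ) (Du : Space d → Space d) (H : Space d → Mat d),
      IsSolution L Ω f g u Du → IsH2 Ω u Du H →
      ∀ (T : Mesh Ω) (F : Finset (Space d) → Space d →ᵃ[ℝ] Space d),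
      (∀ K ∈ T.elements, F K '' simplex Khat = simplex K) →
      ∀ uh : Space d → ℝ, IsFESolution L T f g uh →
      ∀ A : Finset (Space d) → Mat d, (∀ K ∈ T.elements, (A K).PosDef) →
      ∀ (α : ℝ) (CRminusK CRplusK : Finset (Space d) → ℝ) (CRminus CRplus : ℝ), 0 < CRminus →
      (∀ K ∈ T.elements, ∀ᵐ x ∂(volume.restrict (simplex K)),
        ScalarLE (CRminusK K) ((A K)⁻¹ * regAbs α (H x))) →
      (∀ K ∈ T.elements, ∀ᵐ x ∂(volume.restrict (simplex K)),
        LEScalar ((A K)⁻¹ * matAbs (H x)) (CRplusK K)) →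
      (∀ K ∈ T.elements, CRminus ≤ CRminusK K) →
      √((1 / (T.N : ℝ)) * ∑ K ∈ T.elements, CRplusK K ^ 2) ≤ CRplus →
      ∀ Ceq Cali : ℝ, 0 ≤ Ceq → 0 ≤ Cali →
      IsQuasiMUniform T F (fun K => metricTensor (A K)) Ceq Cali →
      gradSeminorm Ω (fun x => Du x - gradient uh x) ≤
        C * (Cali ^ (((d : ℝ) + 1) / 2) * Ceq ^ (((d : ℝ) + 2) / (2 * (d : ℝ)))) *
          (CRplus / CRminus) * (T.N : ℝ) ^ (-(1 / (d : ℝ))) *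
          hessianFactor Ω α H ^ (1 / 2 : ℝ) := by
  obtain ⟨C₁, hC₁, hcea⟩ := exists_cea_constant hd hΩ hbdd hL
  obtain ⟨C₂, hC₂, hinterp⟩ := exists_interpolation_constant hd hΩ hbdd hKhat
  refine ⟨√(C₁ * C₂), by positivity, fun f g hf u Du H hsol hu T F hF uh huh A hA α Cm Cp ρ C hρ
    hm hp hρm hC Ceq Cali hCeq hCali hM => ?_⟩
  obtain ⟨v, hv, hvu⟩ := T.exists_interpolant u
  have hlower : ∀ K ∈ T.elements, ∀ᵐ x ∂(volume.restrict (simplex K)),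
      ρ • A K ≤ regAbs α (H x) := fun K hK => (hm K hK).mono fun x hx =>
    smul_le_of_scalarLE (hA K hK) (regAbs_isHermitian α _) fun μ hμ => (hρm K hK).trans (hx μ hμ)
  have hupper : ∀ K ∈ T.elements, ∀ᵐ x ∂(volume.restrict (simplex K)),
      matAbs (H x) ≤ |Cp K| • A K := fun K hK => (hp K hK).mono fun x hx =>
    le_smul_of_leScalar (hA K hK) (matAbs_posSemidef _).isHermitian
      fun μ hμ => (hx μ hμ).trans (le_abs_self _)
  have hw := fun K hK => metricVol_metricTensor_nonneg (K := K) hd (hA K hK)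
  have herror := (hcea hf hu.isL2Pair hsol huh hv hvu).trans (mul_le_mul_of_nonneg_left
    (hinterp hsol.continuousOn hu hF hv hvu hA (fun K => abs_nonneg (Cp K)) hupper
      hM.alignment) hC₁.le)
  simp only [sq_abs] at herror
  have hsum := sum_sq_mul_rpow_le_of_equidistributed (q := ((d : ℝ) + 2) / d) (by positivity) hCeq
    hw hM.equidistribution hC
  refine sqrt_le_error_bound (by positivity) hCali hCeq hρ ((Real.sqrt_nonneg _).trans hC)
    (Nat.cast_nonneg _) hd (herror.trans ?_)
    (T.sq_mul_rpow_sum_le_hessianFactor hd hΩ hρ hA hlower hupper)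
    (Real.rpow_nonneg (Finset.sum_nonneg hw) _)
  rw [← mul_assoc, ← mul_assoc, mul_assoc]
  gcongr
  exact hsum

theorem theorem3p1 {d : ℕ} (hd : 1 ≤ d)
    -- polyhedral domain, elliptic operator, reference element
    (Ω : Set (Space d)) (hΩ : IsPolyhedralDomain Ω)
    (L : Coeffs d) (hL : L.IsElliptic Ω)
    (Khat : Finset (Space d)) (hKhat : IsReferenceElement Khat) :
    -- `C` depends on these only
    ∃ C : ℝ, 0 < C ∧
      ∀ (f g : Space d → ℝ), MemLp f 2 (volume.restrict Ω) →
      -- the solution of the boundary value problem is in `H²(Ω)`, with Hessian `H`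
      ∀ (u : Space d → ℝ) (Du : Space d → Space d) (H : Space d → Mat d),
      IsSolution L Ω f g u Du → IsH2 Ω u Du H →
      -- mesh, affine maps from the reference element, finite element solution
      ∀ (T : Mesh Ω) (F : Finset (Space d) → Space d →ᵃ[ℝ] Space d),
      (∀ K ∈ T.elements, F K '' simplex Khat = simplex K) →
      ∀ uh : Space d → ℝ, IsFESolution L T f g uh →
      -- recovered Hessian and its averages over the elements
      ∀ (R : Space d → Mat d) (RK : Finset (Space d) → Mat d),
      (∀ x ∈ closure Ω, (R x).IsSymm) →
      (∀ K ∈ T.elements, IsAverageOver (simplex K) R (RK K)) →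
      ∀ α : ℝ, 0 < α →
      -- closeness conditions
      ∀ (CRminusK CRplusK : Finset (Space d) → ℝ) (CRminus CRplus : ℝ),
      0 < CRminus → 0 < CRplus →
      (∀ K ∈ T.elements, ∀ᵐ x ∂(volume.restrict (simplex K)),
        ScalarLE (CRminusK K) ((regAbs α (RK K))⁻¹ * regAbs α (H x))) →
      (∀ K ∈ T.elements, ∀ᵐ x ∂(volume.restrict (simplex K)),
        LEScalar ((regAbs α (RK K))⁻¹ * matAbs (H x)) (CRplusK K)) →
      (∀ K ∈ T.elements, CRminus ≤ CRminusK K) →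
      Real.sqrt ((1 / (T.N : ℝ)) * ∑ K ∈ T.elements, CRplusK K ^ 2) ≤ CRplus →
      -- quasi-`M`-uniformity
      ∀ Ceq Cali : ℝ, 1 ≤ Ceq → 1 ≤ Cali →
      IsQuasiMUniform T F (fun K => metric α (RK K)) Ceq Cali →
      gradSeminorm Ω (fun x => Du x - gradient uh x) ≤
        C * (Cali ^ (((d : ℝ) + 1) / 2) * Ceq ^ (((d : ℝ) + 2) / (2 * (d : ℝ)))) *
          (CRplus / CRminus) * (T.N : ℝ) ^ (-(1 / (d : ℝ))) *
          hessianFactor Ω α H ^ (1 / 2 : ℝ) := by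
  obtain ⟨T₀⟩ := hΩ.nonempty_mesh
  obtain ⟨C, hC, h⟩ := theorem3p1_general hd hΩ.isOpen T₀.isBounded hL hKhat
  exact ⟨C, hC, fun f g hf u Du H hsol hu T F hF uh huh _ RK _ _ α hα Cm Cp ρ Cplus hρ _ hm hp hρm
    hCp Ceq Cali hCeq hCali hM => h f g hf u Du H hsol hu T F hF uh huh _
      (fun K _ => regAbs_posDef hα (RK K)) α Cm Cp ρ Cplus hρ hm hp hρm hCp Ceq Cali
      (zero_le_one.trans hCeq) (zero_le_one.trans hCali) hM⟩
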